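/- For $N\ge 1$, call a random matrix $A_N$ on a probability space a normalized GUE($N$) if $A_N=\frac1{\sqrt N}(a_{ij})_{i,j=1}^N$, where $a_{ij}=\overline{a_{ji}}$ for all $i,j$, the family $\{a_{ij} : i\ge j\}$ is independent, each $a_{ii}$ is a standard real Gaussian variable, and each $a_{ij}$ with $i\ne j$ is a standard complex Gaussian variable, i.e. $a_{ij}=(X+iY)/\sqrt2$ with $X,Y$ independent standard real Gaussian variables. Let $\lambda_{\max}(A_N)$ denote the largest eigenvalue of $A_N$. (1) Convergence in probability. If, for every $N\ge1$, $A_N$ is a normalized GUE($N$) on a probability space $(\Omega_N,\mathbb P_N)$, then for every $\varepsilon>0$ $$\lim_{N\to\infty}\mathbb P_N\big(|\lambda_{\max}(A_N)-2|\ge\varepsilon\big)=0 .$$ (2) Almost sure convergence. If, for every $N\ge1$, $A_N$ is a normalized GUE($N$), all of them defined on one common probability space $(\Omega,\mathbb P)$ (with no assumption on the joint distribution of the $A_N$ for different $N$), then $$\lambda_{\max}(A_N)\xrightarrow{N\to\infty}2\qquad\text{almost surely.}$$ -/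

import Mathlib

open MeasureTheory ProbabilityTheory Filter Topology
open scoped ENNReal

/-- `Z` is a standard complex Gaussian random variable on the probability space `(Ω, P)`:
`Z = (X + i Y) / √2` with `X`, `Y` independent standard real Gaussian variables. -/
def IsStdComplexGaussian {Ω : Type*} [MeasurableSpace Ω] (P : Measure Ω) (Z : Ω → ℂ) : Prop :=
  ∃ X Y : Ω → ℝ,
    HasLaw X (gaussianReal 0 1) P ∧ HasLaw Y (gaussianReal 0 1) P ∧ IndepFun X Y P ∧
      ∀ ω, Z ω = ((X ω : ℂ) + Complex.I * (Y ω : ℂ)) / (Real.sqrt 2 : ℂ)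

/-- `Z` is a standard real Gaussian random variable, regarded as complex-valued. -/
def IsStdRealGaussian {Ω : Type*} [MeasurableSpace Ω] (P : Measure Ω) (Z : Ω → ℂ) : Prop :=
  ∃ X : Ω → ℝ, HasLaw X (gaussianReal 0 1) P ∧ ∀ ω, Z ω = (X ω : ℂ)

/-- Selfadjoint random matrix `a = (a i j)` whose entries on and below the diagonal are
independent standard Gaussians, real on the diagonal and complex off the diagonal
(the unnormalized `GUE(N)`). -/
structure IsUnnormalizedGUE {Ω : Type*} [MeasurableSpace Ω] (P : Measure Ω) {N : ℕ}
    (a : Ω → Matrix (Fin N) (Fin N) ℂ) : Prop where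
  isHermitian : ∀ ω, (a ω).IsHermitian
  indep : iIndepFun
    (fun (p : {p : Fin N × Fin N // p.2 ≤ p.1}) (ω : Ω) => a ω p.1.1 p.1.2) P
  diag : ∀ i, IsStdRealGaussian P (fun ω => a ω i i)
  offDiag : ∀ i j, i ≠ j → IsStdComplexGaussian P (fun ω => a ω i j)

/-- The normalized `GUE(N)`: `A = N^{-1/2} a` with `a` an unnormalized `GUE(N)`. -/
def IsGUE {Ω : Type*} [MeasurableSpace Ω] (P : Measure Ω) {N : ℕ}
    (A : Ω → Matrix (Fin N) (Fin N) ℂ) : Prop :=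
  ∃ a : Ω → Matrix (Fin N) (Fin N) ℂ, IsUnnormalizedGUE P a ∧
    ∀ ω, A ω = (1 / (Real.sqrt N : ℂ)) • a ω

/-- The largest real eigenvalue of a complex `N × N` matrix. For Hermitian matrices with `1 ≤ N`
all eigenvalues are real and the supremum is a maximum, see `isGreatest_largestEigenvalue`. -/
noncomputable def largestEigenvalue {N : ℕ} (A : Matrix (Fin N) (Fin N) ℂ) : ℝ :=
  sSup (spectrum ℝ A)

theorem isGreatest_largestEigenvalue {N : ℕ} (hN : 1 ≤ N) {A : Matrix (Fin N) (Fin N) ℂ}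
    (hA : A.IsHermitian) :
    IsGreatest (Set.range hA.eigenvalues) (largestEigenvalue A) := by
  have : Nonempty (Fin N) := ⟨⟨0, hN⟩⟩
  unfold largestEigenvalue
  rw [hA.spectrum_real_eq_range_eigenvalues]
  have hfin : (Set.range hA.eigenvalues).Finite := Set.finite_range _
  exact ⟨(Set.range_nonempty _).csSup_mem hfin, fun x hx => le_csSup hfin.bddAbove hx⟩

/-! This is a moment method in which all probabilistic input passes through one recursion. Gaussian
integration by parts shows that the mixed moments `T s` of normalized traces solve `LoopSystem` with
`x = N⁻²` (`IsGUE.loopSystem`): differentiating a power of the matrix splits a trace in two, and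
differentiating another trace merges two traces at the price of a factor `x`. At `x = 0` the
solution is the product of semicircle moments.

Since every term of the recursion is nonnegative, solutions can be compared by induction on total
degree. Dropping the merge terms gives `prod_semicircleMoment_le`. At fixed degree the merge terms
cost `O(x)` (`exists_le_add_mul`), so each normalized trace has mean square deviation `O(N⁻²)` from
its semicircle moment. For degrees growing with `N`, `le_prod_of_supersolution` is applied to a
slightly inflated Catalan sequence, which gives `T {2k} ≤ (4(1+2η))^k` as long as `x (D+1)^8` is
small (`apply_singleton_le`).

Upper edge: Markov's inequality for a moment of degree proportional to `log N` bounds the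
probability of an eigenvalue outside `(-2-ε, 2+ε)` by a multiple of `N⁻²`. Lower edge: if all
eigenvalues are at least `-3` and finitely many trace moments are close to the semicircle moments,
the largest eigenvalue exceeds `2 - ε` (`exists_moment_bound_imp_lt_largestEigenvalue`); Chebyshev's
inequality supplies the closeness, again up to probability `O(N⁻²)`.

The resulting tail bound is summable and depends on `N` and `ε` only. Hence convergence in
probability, and by the first Borel–Cantelli lemma almost sure convergence under any coupling of the
matrices. -/

/-! ### Loop equations and induction on total degree. -/

/-- The loop (Schwinger–Dyson) equations satisfied by the mixed trace moments
`T s = 𝔼 ∏ k ∈ s, tr (A ^ k)` of a normalized `GUE(N)`, with `x = N⁻²`. -/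
structure LoopSystem (x : ℝ) (T : Multiset ℕ → ℝ) : Prop where
  zero : T 0 = 1
  cons_zero : ∀ s, T (0 ::ₘ s) = T s
  cons_succ : ∀ k s, T ((k + 1) ::ₘ s) =
    ∑ j ∈ Finset.range k, T (j ::ₘ (k - 1 - j) ::ₘ s) +
      x * (s.map fun m : ℕ => (m : ℝ) * T ((k + m - 1) ::ₘ s.erase m)).sum

/-- Both kinds of term on the right of the loop equation have smaller total degree. Removing a zero
keeps the degree, so an induction on the multiset is nested inside the strong induction on the sum.
-/
theorem Multiset.nat_sum_induction {P : Multiset ℕ → Prop} (h0 : P 0)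
    (hz : ∀ s, P s → P (0 ::ₘ s))
    (hs : ∀ k s, (∀ t : Multiset ℕ, t.sum < k + 1 + s.sum → P t) → P ((k + 1) ::ₘ s))
    (s : Multiset ℕ) : P s := by
  have key : ∀ n, ∀ s : Multiset ℕ, s.sum = n → P s := by
    intro n
    induction n using Nat.strong_induction_on with
    | _ n ih =>
      intro s
      induction s using Multiset.induction_on with
      | empty => exact fun _ => h0
      | cons a s ihs =>
        intro hsum
        rw [Multiset.sum_cons] at hsum
        rcases a with _ | k
        · exact hz s (ihs (by omega))
        · exact hs k s fun t ht => ih _ (hsum ▸ ht) t rfl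
  exact key _ s rfl

theorem Multiset.sum_loop_split_lt {k j : ℕ} (hj : j < k) (s : Multiset ℕ) :
    (j ::ₘ (k - 1 - j) ::ₘ s).sum < k + 1 + s.sum := by
  simp only [Multiset.sum_cons]; omega

theorem Multiset.sum_loop_merge_lt (k : ℕ) {m : ℕ} {s : Multiset ℕ} (hm : m ∈ s) :
    ((k + m - 1) ::ₘ s.erase m).sum < k + 1 + s.sum := by
  have := Multiset.sum_erase hm
  simp only [Multiset.sum_cons]; omega

/-! ### Semicircle moments and Catalan convolutions. -/

/-- The moments of the semicircle law. -/
def semicircleMoment (k : ℕ) : ℝ := if Even k then (catalan (k / 2) : ℝ) else 0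

@[simp] theorem semicircleMoment_two_mul (a : ℕ) : semicircleMoment (2 * a) = catalan a := by
  simp [semicircleMoment]

@[simp] theorem semicircleMoment_two_mul_add_one (a : ℕ) :
    semicircleMoment (2 * a + 1) = 0 := by
  simp [semicircleMoment]

@[simp] theorem semicircleMoment_zero : semicircleMoment 0 = 1 := by
  simp [semicircleMoment]

theorem semicircleMoment_nonneg (k : ℕ) : 0 ≤ semicircleMoment k := by
  unfold semicircleMoment; split_ifs <;> positivity

theorem sum_range_two_mul {M : Type*} [AddCommMonoid M] (F : ℕ → M) (n : ℕ) :
    ∑ j ∈ Finset.range (2 * n), F j =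
      ∑ i ∈ Finset.range n, F (2 * i) + ∑ i ∈ Finset.range n, F (2 * i + 1) := by
  induction n with
  | zero => simp
  | succ n ih =>
    rw [show 2 * (n + 1) = 2 * n + 1 + 1 by ring, Finset.sum_range_succ, Finset.sum_range_succ, ih,
      Finset.sum_range_succ, Finset.sum_range_succ]
    abel

theorem sum_range_two_mul_add_one {M : Type*} [AddCommMonoid M] (F : ℕ → M) (n : ℕ) :
    ∑ j ∈ Finset.range (2 * n + 1), F j =
      ∑ i ∈ Finset.range (n + 1), F (2 * i) + ∑ i ∈ Finset.range n, F (2 * i + 1) := by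
  rw [Finset.sum_range_succ, sum_range_two_mul, Finset.sum_range_succ]
  abel

theorem catalan_succ_range (n : ℕ) :
    catalan (n + 1) = ∑ i ∈ Finset.range (n + 1), catalan i * catalan (n - i) := by
  rw [catalan_succ, Finset.sum_range]

/-- Writing the central binomial as `(n - i + 1) * catalan (n - i)` and averaging with the reflected
sum makes the weights constant, equal to `n + 2` in total. The identity says that central binomials
solve the Catalan recursion linearised at the Catalan numbers, which is why they serve as odd-index
values below. -/
theorem two_mul_sum_catalan_mul_centralBinom (n : ℕ) :
    2 * ∑ i ∈ Finset.range (n + 1), catalan i * Nat.centralBinom (n - i) =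
      Nat.centralBinom (n + 1) := by
  have h1 : ∑ i ∈ Finset.range (n + 1), catalan i * Nat.centralBinom (n - i) =
      ∑ i ∈ Finset.range (n + 1), (n - i + 1) * (catalan i * catalan (n - i)) := by
    refine Finset.sum_congr rfl fun i _ => ?_
    rw [← succ_mul_catalan_eq_centralBinom]; ring
  have h2 : ∑ i ∈ Finset.range (n + 1), catalan i * Nat.centralBinom (n - i) =
      ∑ i ∈ Finset.range (n + 1), (i + 1) * (catalan i * catalan (n - i)) := by
    rw [h1, ← Finset.sum_range_reflect]
    refine Finset.sum_congr rfl fun i hi => ?_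
    have := Finset.mem_range.1 hi
    rw [show n + 1 - 1 - i = n - i by omega, show n - (n - i) = i by omega, mul_comm (catalan i)]
  rw [two_mul]
  nth_rewrite 1 [h1]
  rw [h2, ← Finset.sum_add_distrib, ← succ_mul_catalan_eq_centralBinom, catalan_succ_range,
    Finset.mul_sum]
  refine Finset.sum_congr rfl fun i hi => ?_
  have := Finset.mem_range.1 hi
  rw [← add_mul]
  congr 1
  omega

theorem semicircleMoment_succ (k : ℕ) : semicircleMoment (k + 1) =
    ∑ j ∈ Finset.range k, semicircleMoment j * semicircleMoment (k - 1 - j) := by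
  obtain ⟨a, rfl | rfl⟩ := k.even_or_odd'
  · rw [semicircleMoment_two_mul_add_one, eq_comm]
    refine Finset.sum_eq_zero fun j hj => ?_
    have hj := Finset.mem_range.1 hj
    obtain ⟨b, rfl | rfl⟩ := j.even_or_odd'
    · rw [show 2 * a - 1 - 2 * b = 2 * (a - 1 - b) + 1 by omega,
        semicircleMoment_two_mul_add_one, mul_zero]
    · rw [semicircleMoment_two_mul_add_one, zero_mul]
  · rw [sum_range_two_mul_add_one, show 2 * a + 1 + 1 = 2 * (a + 1) by ring,
      semicircleMoment_two_mul, catalan_succ_range]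
    simp only [semicircleMoment_two_mul_add_one, zero_mul, Finset.sum_const_zero, add_zero]
    push_cast
    refine Finset.sum_congr rfl fun i hi => ?_
    have := Finset.mem_range.1 hi
    rw [show 2 * a - 2 * i = 2 * (a - i) by omega, semicircleMoment_two_mul,
      semicircleMoment_two_mul]

theorem prod_semicircleMoment_nonneg (s : Multiset ℕ) : 0 ≤ (s.map semicircleMoment).prod :=
  Multiset.prod_nonneg fun a ha => by
    obtain ⟨k, -, rfl⟩ := Multiset.mem_map.1 ha
    exact semicircleMoment_nonneg k

/-! ### Comparison principles for the loop equations. -/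

namespace LoopSystem

variable {x : ℝ} {T : Multiset ℕ → ℝ}

/-- The merge terms are nonnegative by induction; without them the recursion is the one solved by
products of semicircle moments. -/
theorem prod_semicircleMoment_le (h : LoopSystem x T) (hx : 0 ≤ x) (s : Multiset ℕ) :
    (s.map semicircleMoment).prod ≤ T s := by
  induction s using Multiset.nat_sum_induction with
  | h0 => simp [h.zero]
  | hz s ih => simpa [h.cons_zero] using ih
  | hs k s ih =>
    rw [h.cons_succ, Multiset.map_cons, Multiset.prod_cons, semicircleMoment_succ, Finset.sum_mul]
    have h1 : ∑ j ∈ Finset.range k, semicircleMoment j * semicircleMoment (k - 1 - j) *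
        (s.map semicircleMoment).prod ≤
        ∑ j ∈ Finset.range k, T (j ::ₘ (k - 1 - j) ::ₘ s) := by
      refine Finset.sum_le_sum fun j hj => ?_
      refine le_trans (le_of_eq ?_)
        (ih _ (Multiset.sum_loop_split_lt (Finset.mem_range.1 hj) s))
      simp [mul_assoc]
    have h2 : 0 ≤ (s.map fun m : ℕ => (m : ℝ) * T ((k + m - 1) ::ₘ s.erase m)).sum := by
      refine Multiset.sum_nonneg fun a ha => ?_
      obtain ⟨m, hm, rfl⟩ := Multiset.mem_map.1 ha
      exact mul_nonneg m.cast_nonneg ((prod_semicircleMoment_nonneg _).trans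
        (ih _ (Multiset.sum_loop_merge_lt k hm)))
    nlinarith [mul_nonneg hx h2]

/-- The constant is chosen before `x` and `T`, so for the GUE it is uniform in `N`. -/
theorem exists_le_add_mul (s : Multiset ℕ) :
    ∃ C : ℝ, ∀ (x : ℝ) (T : Multiset ℕ → ℝ), LoopSystem x T → 0 ≤ x → x ≤ 1 →
      T s ≤ (s.map semicircleMoment).prod + C * x := by
  induction s using Multiset.nat_sum_induction with
  | h0 => exact ⟨0, fun x T h _ _ => by simp [h.zero]⟩
  | hz s ih =>
    obtain ⟨C, hC⟩ := ih
    exact ⟨C, fun x T h h0 h1 => by simpa [h.cons_zero] using hC x T h h0 h1⟩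
  | hs k s ih =>
    choose! C hC using ih
    -- Merge terms already carry a factor `x`, so a crude bound on them suffices: `x ≤ 1` turns `C *
    -- x` into `|C|`.
    refine ⟨∑ j ∈ Finset.range k, C (j ::ₘ (k - 1 - j) ::ₘ s) +
      (s.map fun m : ℕ => (m : ℝ) * ((((k + m - 1) ::ₘ s.erase m).map semicircleMoment).prod +
        |C ((k + m - 1) ::ₘ s.erase m)|)).sum, fun x T h h0 h1 => ?_⟩
    rw [h.cons_succ, Multiset.map_cons, Multiset.prod_cons, semicircleMoment_succ, Finset.sum_mul,
      add_mul, ← add_assoc, Finset.sum_mul, ← Finset.sum_add_distrib]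
    refine add_le_add (Finset.sum_le_sum fun j hj => ?_) ?_
    · refine (hC _ (Multiset.sum_loop_split_lt (Finset.mem_range.1 hj) s) x T h h0 h1).trans
        (le_of_eq ?_)
      simp [mul_assoc]
    · rw [mul_comm x]
      refine mul_le_mul_of_nonneg_right (Multiset.sum_map_le_sum_map _ _ fun m hm => ?_) h0
      refine mul_le_mul_of_nonneg_left
        ((hC _ (Multiset.sum_loop_merge_lt k hm) x T h h0 h1).trans ?_) m.cast_nonneg
      gcongr
      nlinarith [le_abs_self (C ((k + m - 1) ::ₘ s.erase m)),
        abs_nonneg (C ((k + m - 1) ::ₘ s.erase m))]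

/-- Any supersolution of the loop equations up to degree `D` dominates the solution. -/
theorem le_prod_of_supersolution (h : LoopSystem x T) (hx : 0 ≤ x) {f : ℕ → ℝ}
    (hf0 : f 0 = 1) (hfpos : ∀ k, 0 < f k) {D : ℕ} {R : ℝ} (hR : 0 ≤ R)
    (hconv : ∀ k, k + 1 ≤ D →
      ∑ j ∈ Finset.range k, f j * f (k - 1 - j) + x * (D * R * f (k + 1)) ≤ f (k + 1))
    (hratio : ∀ k m, 1 ≤ m → k + 1 + m ≤ D → f (k + m - 1) ≤ R * (f (k + 1) * f m))
    (s : Multiset ℕ) (hs : s.sum ≤ D) : T s ≤ (s.map f).prod := by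
  induction s using Multiset.nat_sum_induction with
  | h0 => simp [h.zero]
  | hz s ih => simpa [h.cons_zero, hf0] using ih (by simpa using hs)
  | hs k s ih =>
    rw [Multiset.sum_cons] at hs
    have hP : 0 < (s.map f).prod := Multiset.prod_pos fun a ha => by
      obtain ⟨k, -, rfl⟩ := Multiset.mem_map.1 ha
      exact hfpos k
    rw [h.cons_succ, Multiset.map_cons, Multiset.prod_cons]
    have h1 : ∑ j ∈ Finset.range k, T (j ::ₘ (k - 1 - j) ::ₘ s) ≤
        (∑ j ∈ Finset.range k, f j * f (k - 1 - j)) * (s.map f).prod := by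
      rw [Finset.sum_mul]
      refine Finset.sum_le_sum fun j hj => ?_
      have hlt := Multiset.sum_loop_split_lt (Finset.mem_range.1 hj) s
      refine (ih _ hlt (by omega)).trans (le_of_eq ?_)
      simp [mul_assoc]
    -- The ratio hypothesis restores the two factors lost in a merge at cost `R`; the weights `m`
    -- then add up to `s.sum ≤ D`.
    have h2 : (s.map fun m : ℕ => (m : ℝ) * T ((k + m - 1) ::ₘ s.erase m)).sum ≤
        D * R * f (k + 1) * (s.map f).prod := by
      have h3 : (s.map fun m : ℕ => (m : ℝ) * T ((k + m - 1) ::ₘ s.erase m)).sum ≤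
          (s.map fun m : ℕ => (m : ℝ) * (R * f (k + 1) * (s.map f).prod)).sum := by
        refine Multiset.sum_map_le_sum_map _ _ fun m hm => ?_
        rcases Nat.eq_zero_or_pos m with rfl | hm0
        · simp
        refine mul_le_mul_of_nonneg_left ?_ m.cast_nonneg
        have hlt := Multiset.sum_loop_merge_lt k hm
        have hle : m ≤ s.sum := Multiset.le_sum_of_mem hm
        refine (ih _ hlt (by omega)).trans ?_
        rw [Multiset.map_cons, Multiset.prod_cons, ← Multiset.prod_map_erase hm]
        have hP' : 0 ≤ ((s.erase m).map f).prod := Multiset.prod_nonneg fun a ha => by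
          obtain ⟨k, -, rfl⟩ := Multiset.mem_map.1 ha
          exact (hfpos k).le
        calc _ ≤ R * (f (k + 1) * f m) * ((s.erase m).map f).prod :=
              mul_le_mul_of_nonneg_right (hratio k m hm0 (by omega)) hP'
          _ = _ := by ring
      refine h3.trans ?_
      rw [Multiset.sum_map_mul_right]
      have h4 : (s.map fun m : ℕ => (m : ℝ)).sum = (s.sum : ℝ) := by
        rw [Nat.cast_multiset_sum]
      have h5 : (s.sum : ℝ) ≤ D := by exact_mod_cast (by omega : s.sum ≤ D)
      rw [h4]
      have := hfpos (k + 1)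
      calc _ ≤ (D : ℝ) * (R * f (k + 1) * (s.map f).prod) := by gcongr
        _ = _ := by ring
    calc _ ≤ (∑ j ∈ Finset.range k, f j * f (k - 1 - j)) * (s.map f).prod +
          x * (D * R * f (k + 1) * (s.map f).prod) := by gcongr
      _ = (∑ j ∈ Finset.range k, f j * f (k - 1 - j) + x * (D * R * f (k + 1))) *
          (s.map f).prod := by ring
      _ ≤ _ := mul_le_mul_of_nonneg_right (hconv k (by omega)) hP.le

end LoopSystem

/-! ### A positive supersolution of the loop equations. -/

/-- Catalan numbers at even indices, interpolated at odd indices by `δ` times the central binomial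
coefficients, so that the Catalan convolution inequality nearly persists. -/
noncomputable def interpolatedCatalan (δ : ℝ) (k : ℕ) : ℝ :=
  if Even k then (catalan (k / 2) : ℝ) else δ * Nat.centralBinom (k / 2)

namespace interpolatedCatalan

variable {δ : ℝ}

@[simp] theorem two_mul (a : ℕ) : interpolatedCatalan δ (2 * a) = catalan a := by
  simp [interpolatedCatalan]

@[simp] theorem two_mul_add_one (a : ℕ) :
    interpolatedCatalan δ (2 * a + 1) = δ * Nat.centralBinom a := by
  have : (2 * a + 1) / 2 = a := by omega
  simp [interpolatedCatalan, this]

end interpolatedCatalan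

theorem catalan_le_four_pow (a : ℕ) : catalan a ≤ 4 ^ a := by
  have := succ_mul_catalan_eq_centralBinom a
  have := Nat.centralBinom_le_four_pow a
  nlinarith

theorem four_pow_le_mul_centralBinom (a : ℕ) : 4 ^ a ≤ (2 * a + 1) * Nat.centralBinom a := by
  rw [Nat.centralBinom_eq_two_mul_choose]
  exact Nat.four_pow_le_two_mul_add_one_mul_central_binom a

theorem four_pow_le_mul_catalan (a : ℕ) : 4 ^ a ≤ (2 * a + 1) * (a + 1) * catalan a := by
  rw [mul_assoc, succ_mul_catalan_eq_centralBinom]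
  exact four_pow_le_mul_centralBinom a

theorem catalan_pos (a : ℕ) : 0 < catalan a := by
  have := four_pow_le_mul_catalan a
  have h4 : 0 < 4 ^ a := by positivity
  by_contra h
  simp only [not_lt, nonpos_iff_eq_zero] at h
  simp [h] at this

namespace interpolatedCatalan

variable {δ : ℝ}

theorem pos (hδ : 0 < δ) (k : ℕ) : 0 < interpolatedCatalan δ k := by
  obtain ⟨a, rfl | rfl⟩ := k.even_or_odd'
  · rw [two_mul]; exact_mod_cast catalan_pos a
  · rw [two_mul_add_one]
    exact mul_pos hδ (by exact_mod_cast Nat.centralBinom_pos a)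

theorem le_two_pow (hδ1 : δ ≤ 1) (k : ℕ) : interpolatedCatalan δ k ≤ 2 ^ k := by
  obtain ⟨a, rfl | rfl⟩ := k.even_or_odd'
  · rw [two_mul, pow_mul]
    have := catalan_le_four_pow a
    norm_num
    exact_mod_cast this
  · rw [two_mul_add_one, pow_succ, pow_mul]
    have h : (Nat.centralBinom a : ℝ) ≤ 4 ^ a := by exact_mod_cast Nat.centralBinom_le_four_pow a
    have h4 : (0 : ℝ) < 4 ^ a := by positivity
    have h0 : (0 : ℝ) ≤ Nat.centralBinom a := by positivity
    norm_num
    nlinarith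

/-- Together with `le_two_pow`, this pins the sequence to `2 ^ k` up to polynomial factors in `D`
and a power of `δ`. This yields the ratio hypothesis of `le_prod_of_supersolution`, which would fail
if odd entries vanished: merging two odd powers produces an even one. -/
theorem two_pow_le (hδ : 0 < δ) (hδ1 : δ ≤ 1) {k D : ℕ} (hk : k ≤ D) :
    δ * 2 ^ k ≤ 2 * (D + 1) ^ 2 * interpolatedCatalan δ k := by
  obtain ⟨a, rfl | rfl⟩ := k.even_or_odd'
  · rw [two_mul, pow_mul]
    have h : (4 : ℝ) ^ a ≤ (2 * a + 1) * (a + 1) * catalan a := by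
      exact_mod_cast four_pow_le_mul_catalan a
    have hD : (2 * a : ℝ) ≤ D := by exact_mod_cast hk
    have h4 : (0 : ℝ) < 4 ^ a := by positivity
    have ha : (0 : ℝ) ≤ a := a.cast_nonneg
    have hc : (0 : ℝ) ≤ catalan a := by positivity
    norm_num
    calc δ * 4 ^ a ≤ 1 * 4 ^ a := by gcongr
      _ ≤ (2 * a + 1) * (a + 1) * catalan a := by rw [one_mul]; exact h
      _ ≤ (2 * (D + 1) ^ 2) * catalan a := by
        refine mul_le_mul_of_nonneg_right ?_ hc
        nlinarith
  · rw [two_mul_add_one, pow_succ, pow_mul]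
    have h : (4 : ℝ) ^ a ≤ (2 * a + 1) * Nat.centralBinom a := by
      exact_mod_cast four_pow_le_mul_centralBinom a
    have hD : (2 * a + 1 : ℝ) ≤ D := by exact_mod_cast hk
    have ha : (0 : ℝ) ≤ a := a.cast_nonneg
    have hc : (0 : ℝ) ≤ Nat.centralBinom a := by positivity
    norm_num
    calc δ * (4 ^ a * 2) ≤ δ * ((2 * a + 1) * Nat.centralBinom a * 2) := by gcongr
      _ = 2 * (2 * a + 1) * (δ * Nat.centralBinom a) := by ring
      _ ≤ _ := by
        refine mul_le_mul_of_nonneg_right ?_ (by positivity)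
        nlinarith

/-- At odd `k + 1` each product has exactly one odd index, and
`two_mul_sum_catalan_mul_centralBinom` gives equality apart from the empty sum. At even `k + 1` the
even-even products reproduce the Catalan recursion; the odd-odd products are the error, of order `δ
^ 2` with a polynomial factor in `D`. -/
theorem convolution_le (hδ : 0 < δ) {k D : ℕ} (hk : k + 1 ≤ D) :
    ∑ j ∈ Finset.range k, interpolatedCatalan δ j * interpolatedCatalan δ (k - 1 - j) ≤
      (1 + δ ^ 2 * (D + 1) ^ 3) * interpolatedCatalan δ (k + 1) := by
  have hpos := pos hδ (k + 1)
  obtain ⟨a, rfl | rfl⟩ := k.even_or_odd'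
  · have key : ∑ j ∈ Finset.range (2 * a),
        interpolatedCatalan δ j * interpolatedCatalan δ (2 * a - 1 - j) ≤
        interpolatedCatalan δ (2 * a + 1) := by
      rcases a with _ | n
      · simpa using hpos.le
      rw [sum_range_two_mul, two_mul_add_one, ← two_mul_sum_catalan_mul_centralBinom]
      push_cast
      have e : ∀ S : ℝ, δ * (2 * S) = δ * S + δ * S := fun S => by ring
      rw [e, Finset.mul_sum]
      refine le_of_eq ?_
      congr 1
      · refine Finset.sum_congr rfl fun i hi => ?_
        have := Finset.mem_range.1 hi
        rw [show 2 * (n + 1) - 1 - 2 * i = 2 * (n - i) + 1 by omega, two_mul, two_mul_add_one]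
        ring
      · rw [← Finset.sum_range_reflect]
        refine Finset.sum_congr rfl fun i hi => ?_
        have := Finset.mem_range.1 hi
        rw [show 2 * (n + 1) - 1 - (2 * (n + 1 - 1 - i) + 1) = 2 * i by omega,
          show n + 1 - 1 - i = n - i by omega, two_mul, two_mul_add_one]
        ring
    refine key.trans ?_
    have : 0 ≤ δ ^ 2 * ((D : ℝ) + 1) ^ 3 := by positivity
    nlinarith
  · rw [sum_range_two_mul_add_one, show 2 * a + 1 + 1 = 2 * (a + 1) by ring, two_mul, add_mul,
      one_mul]
    refine add_le_add ?_ ?_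
    · rw [catalan_succ_range]
      push_cast
      refine Finset.sum_le_sum fun i hi => ?_
      have := Finset.mem_range.1 hi
      rw [show 2 * a - 2 * i = 2 * (a - i) by omega, two_mul, two_mul]
    · have h1 : ∀ i ∈ Finset.range a, interpolatedCatalan δ (2 * i + 1) *
          interpolatedCatalan δ (2 * a + 1 - 1 - (2 * i + 1)) ≤ δ ^ 2 * 4 ^ a := by
        intro i hi
        have := Finset.mem_range.1 hi
        rw [show 2 * a + 1 - 1 - (2 * i + 1) = 2 * (a - 1 - i) + 1 by omega, two_mul_add_one,
          two_mul_add_one]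
        have hi1 : (Nat.centralBinom i : ℝ) ≤ 4 ^ i := by
          exact_mod_cast Nat.centralBinom_le_four_pow i
        have hi2 : (Nat.centralBinom (a - 1 - i) : ℝ) ≤ 4 ^ (a - 1 - i) := by
          exact_mod_cast Nat.centralBinom_le_four_pow _
        calc _ = δ ^ 2 * (Nat.centralBinom i * Nat.centralBinom (a - 1 - i)) := by ring
          _ ≤ δ ^ 2 * (4 ^ i * 4 ^ (a - 1 - i)) := by gcongr
          _ ≤ δ ^ 2 * 4 ^ a := by
            rw [← pow_add]
            gcongr
            · norm_num
            · omega
      refine (Finset.sum_le_sum h1).trans ?_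
      rw [Finset.sum_const, Finset.card_range, nsmul_eq_mul]
      have h2 : (4 : ℝ) ^ (a + 1) ≤ (2 * (a + 1 : ℕ) + 1) * ((a + 1 : ℕ) + 1) * catalan (a + 1) := by
        exact_mod_cast four_pow_le_mul_catalan (a + 1)
      have hD : (2 * a + 2 : ℝ) ≤ D := by exact_mod_cast (by omega : 2 * a + 2 ≤ D)
      have ha : (0 : ℝ) ≤ a := a.cast_nonneg
      have hc : (0 : ℝ) ≤ catalan (a + 1) := by positivity
      push_cast at h2
      have h3 : (4 : ℝ) ^ a ≤ 4 ^ (a + 1) := by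
        gcongr
        · norm_num
        · omega
      calc (a : ℝ) * (δ ^ 2 * 4 ^ a) ≤ (D + 1) * (δ ^ 2 *
            ((2 * (a + 1) + 1) * ((a + 1) + 1) * catalan (a + 1))) := by
            gcongr
            · linarith
            · exact h3.trans h2
        _ ≤ (D + 1) * (δ ^ 2 * ((D + 1) * (D + 1) * catalan (a + 1))) := by
            gcongr <;> linarith
        _ = _ := by ring

end interpolatedCatalan

theorem LoopSystem.apply_singleton_le {x : ℝ} {T : Multiset ℕ → ℝ} (h : LoopSystem x T)
    (hx : 0 ≤ x) {η : ℝ} (hη : 0 < η) (hη1 : η ≤ 1) {D k : ℕ} (hk : 2 * k ≤ D)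
    (hD : x * (D + 1) ^ 8 * (1 + 2 * η) ≤ η ^ 2) :
    T {2 * k} ≤ (4 * (1 + 2 * η)) ^ k := by
  -- The convolution of `ρ ^ j` loses two powers of `ρ` against `ρ ^ (k + 1)`. The gain `ρ ^ 2 = 1 +
  -- 2η` pays `η` for the convolution error and `η` for the merge terms.
  set ρ : ℝ := Real.sqrt (1 + 2 * η) with hρ
  have hρ2 : ρ ^ 2 = 1 + 2 * η := Real.sq_sqrt (by linarith)
  have hρ1 : 1 ≤ ρ := by rw [hρ]; exact Real.one_le_sqrt.2 (by linarith)
  have hB : (1 : ℝ) ≤ (D + 1) ^ 3 := one_le_pow₀ (by linarith [(D.cast_nonneg : (0 : ℝ) ≤ D)])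
  have hDpos : (0 : ℝ) < D + 1 := by positivity
  -- Chosen so that the error `δ ^ 2 * (D + 1) ^ 3` of `convolution_le` equals `η`.
  set δ : ℝ := Real.sqrt (η / (D + 1) ^ 3) with hδdef
  have hδ2 : δ ^ 2 = η / (D + 1) ^ 3 := Real.sq_sqrt (by positivity)
  have hδ : 0 < δ := Real.sqrt_pos.2 (by positivity)
  have hδ1 : δ ≤ 1 := by
    rw [hδdef, Real.sqrt_le_iff, one_pow, div_le_one (by positivity)]
    refine ⟨zero_le_one, ?_⟩
    linarith
  have hδB : δ ^ 2 * (D + 1) ^ 3 = η := by rw [hδ2]; field_simp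
  have hpos := interpolatedCatalan.pos hδ
  -- Two uses of `two_pow_le` give this ratio. It equals `(D + 1) ^ 7 / η`, and the further factor
  -- `D` accounts for the exponent 8 in `hD`.
  set R : ℝ := (D + 1) ^ 4 / δ ^ 2 with hRdef
  have hR : 0 ≤ R := by positivity
  have hRη : R = (D + 1) ^ 7 / η := by rw [hRdef, hδ2]; field_simp
  have hxDR : x * (D * R) * ρ ^ 2 ≤ η := by
    rw [hρ2, hRη]
    calc _ ≤ x * ((D + 1) * ((D + 1) ^ 7 / η)) * (1 + 2 * η) := by gcongr; linarith
      _ = (x * (D + 1) ^ 8 * (1 + 2 * η)) / η := by ring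
      _ ≤ η ^ 2 / η := by gcongr
      _ = η := by field_simp
  have main := h.le_prod_of_supersolution hx
    (f := fun k => ρ ^ k * interpolatedCatalan δ k) (D := D) (R := R)
    (by simp [interpolatedCatalan]) (fun k => mul_pos (by positivity) (hpos k)) hR ?_ ?_ {2 * k}
    (by simpa using hk)
  · refine main.trans ?_
    simp only [Multiset.map_singleton, Multiset.prod_singleton, interpolatedCatalan.two_mul]
    have : (catalan k : ℝ) ≤ 4 ^ k := by exact_mod_cast catalan_le_four_pow k
    rw [pow_mul, hρ2, mul_pow, mul_comm]
    gcongr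
  · intro k hk
    -- At index 0 the convolution is empty, so only the merge term has to be absorbed.
    rcases k with _ | k
    · have : x * (D * R) ≤ 1 := by
        have h1 : 0 ≤ x * (D * R) := by positivity
        nlinarith
      have h2 := mul_pos (pow_pos (by linarith : 0 < ρ) (0 + 1)) (hpos (0 + 1))
      simp only [Finset.range_zero, Finset.sum_empty, zero_add] at h2 ⊢
      nlinarith
    have h1 : ∑ j ∈ Finset.range (k + 1), ρ ^ j * interpolatedCatalan δ j *
        (ρ ^ (k + 1 - 1 - j) * interpolatedCatalan δ (k + 1 - 1 - j)) =
        ρ ^ k * ∑ j ∈ Finset.range (k + 1),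
          interpolatedCatalan δ j * interpolatedCatalan δ (k + 1 - 1 - j) := by
      rw [Finset.mul_sum]
      refine Finset.sum_congr rfl fun j hj => ?_
      have := Finset.mem_range.1 hj
      have h2 : ρ ^ k = ρ ^ j * ρ ^ (k + 1 - 1 - j) := by rw [← pow_add]; congr 1; omega
      rw [h2]; ring
    have h3 := interpolatedCatalan.convolution_le hδ hk
    rw [hδB] at h3
    rw [h1]
    have hρk : 0 < ρ ^ k := by positivity
    have hg := hpos (k + 1 + 1)
    calc _ ≤ ρ ^ k * ((1 + η) * interpolatedCatalan δ (k + 1 + 1)) +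
          x * (D * R * (ρ ^ (k + 1 + 1) * interpolatedCatalan δ (k + 1 + 1))) := by gcongr
      _ = ρ ^ k * interpolatedCatalan δ (k + 1 + 1) * (1 + η + x * (D * R) * ρ ^ 2) := by ring
      _ ≤ ρ ^ k * interpolatedCatalan δ (k + 1 + 1) * ρ ^ 2 := by
        gcongr
        rw [hρ2] at hxDR ⊢
        linarith
      _ = _ := by ring
  · intro k m hm hkm
    have h1 := interpolatedCatalan.le_two_pow hδ1 (k + m - 1)
    have h2 := interpolatedCatalan.two_pow_le hδ hδ1 (by omega : k + 1 ≤ D)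
    have h3 := interpolatedCatalan.two_pow_le hδ hδ1 (by omega : m ≤ D)
    have h4 : (2 : ℝ) ^ (k + m - 1) ≤
        R * (interpolatedCatalan δ (k + 1) * interpolatedCatalan δ m) := by
      have h5 := mul_le_mul h2 h3 (by positivity) (by have := hpos (k + 1); positivity)
      have h6 : δ * 2 ^ (k + 1) * (δ * 2 ^ m) = 4 * δ ^ 2 * 2 ^ (k + m - 1) := by
        have : k + 1 + m = (k + m - 1) + 2 := by omega
        calc _ = δ ^ 2 * 2 ^ (k + 1 + m) := by ring
          _ = _ := by rw [this, pow_add]; ring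
      rw [h6] at h5
      rw [hRdef, div_mul_eq_mul_div, le_div_iff₀ (by positivity)]
      nlinarith
    have h7 : ρ ^ (k + m - 1) ≤ ρ ^ (k + 1 + m) := pow_le_pow_right₀ hρ1 (by omega)
    have hp := interpolatedCatalan.pos hδ (k + m - 1)
    calc _ ≤ ρ ^ (k + 1 + m) * (R * (interpolatedCatalan δ (k + 1) * interpolatedCatalan δ m)) :=
          mul_le_mul h7 (h1.trans h4) hp.le (by positivity)
      _ = _ := by ring

/-! ### Expectations of polynomials and Gaussian integration by parts. -/

section Moments

variable {Ω : Type*} [MeasurableSpace Ω] {P : Measure Ω}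

/-- All absolute moments of `f` are finite. -/
def HasFiniteMoments (P : Measure Ω) (f : Ω → ℂ) : Prop := ∀ p : ℕ, MemLp f p P

namespace HasFiniteMoments

variable {f g : Ω → ℂ}

theorem integrable (hf : HasFiniteMoments P f) : Integrable f P :=
  memLp_one_iff_integrable.1 (by simpa using hf 1)

theorem aestronglyMeasurable (hf : HasFiniteMoments P f) : AEStronglyMeasurable f P :=
  hf.integrable.aestronglyMeasurable

theorem const [IsFiniteMeasure P] (c : ℂ) : HasFiniteMoments P fun _ => c :=
  fun _ => memLp_const c

theorem add (hf : HasFiniteMoments P f) (hg : HasFiniteMoments P g) :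
    HasFiniteMoments P fun ω => f ω + g ω := fun p => (hf p).add (hg p)

theorem mul (hf : HasFiniteMoments P f) (hg : HasFiniteMoments P g) :
    HasFiniteMoments P fun ω => f ω * g ω := fun p => by
  have : ENNReal.HolderTriple ((2 * p : ℕ) : ℝ≥0∞) ((2 * p : ℕ) : ℝ≥0∞) p := by
    constructor
    push_cast
    rw [ENNReal.mul_inv (by simp) (by simp), ← add_mul, ENNReal.inv_two_add_inv_two, one_mul]
  exact MemLp.mul' (hg (2 * p)) (hf (2 * p))

theorem pow [IsFiniteMeasure P] (hf : HasFiniteMoments P f) (n : ℕ) :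
    HasFiniteMoments P fun ω => f ω ^ n := by
  induction n with
  | zero => simpa using const 1
  | succ n ih => simpa only [pow_succ] using ih.mul hf

theorem aeval [IsFiniteMeasure P] {σ : Type*} {ξ : σ → Ω → ℂ}
    (hξ : ∀ s, HasFiniteMoments P (ξ s)) (p : MvPolynomial σ ℂ) :
    HasFiniteMoments P fun ω => MvPolynomial.aeval (fun s => ξ s ω) p := by
  induction p using MvPolynomial.induction_on with
  | C a => simpa using const a
  | add p q hp hq => simpa using hp.add hq
  | mul_X p s hp => simpa using hp.mul (hξ s)

end HasFiniteMoments

/-- The expectation of a polynomial in the random variables `ξ s`. -/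
noncomputable def polyExpectation {σ : Type*} (P : Measure Ω) (ξ : σ → Ω → ℂ)
    (p : MvPolynomial σ ℂ) : ℂ :=
  ∫ ω, MvPolynomial.aeval (fun s => ξ s ω) p ∂P

section PolyExpectation

variable {σ : Type*} {ξ : σ → Ω → ℂ}

theorem polyExpectation_zero : polyExpectation P ξ 0 = 0 := by
  simp [polyExpectation]

theorem polyExpectation_C_mul (c : ℂ) (p : MvPolynomial σ ℂ) :
    polyExpectation P ξ (MvPolynomial.C c * p) = c * polyExpectation P ξ p := by
  simp [polyExpectation, integral_const_mul]

theorem polyExpectation_natCast_mul (c : ℕ) (p : MvPolynomial σ ℂ) :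
    polyExpectation P ξ (c * p) = c * polyExpectation P ξ p := by
  simp [polyExpectation, integral_const_mul]

theorem polyExpectation_monomial [Fintype σ] (u : σ →₀ ℕ) (c : ℂ) :
    polyExpectation P ξ (MvPolynomial.monomial u c) = c * ∫ ω, ∏ s, ξ s ω ^ u s ∂P := by
  simp [polyExpectation, MvPolynomial.aeval_monomial, Finsupp.prod_fintype, integral_const_mul]

variable [IsFiniteMeasure P]

theorem polyExpectation_add (hξ : ∀ s, HasFiniteMoments P (ξ s)) (p q : MvPolynomial σ ℂ) :
    polyExpectation P ξ (p + q) = polyExpectation P ξ p + polyExpectation P ξ q := by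
  simp only [polyExpectation, map_add]
  exact integral_add (HasFiniteMoments.aeval hξ p).integrable
    (HasFiniteMoments.aeval hξ q).integrable

theorem polyExpectation_sum (hξ : ∀ s, HasFiniteMoments P (ξ s)) {ι : Type*} (S : Finset ι)
    (p : ι → MvPolynomial σ ℂ) :
    polyExpectation P ξ (∑ i ∈ S, p i) = ∑ i ∈ S, polyExpectation P ξ (p i) := by
  classical
  induction S using Finset.induction_on with
  | empty => simp [polyExpectation_zero]
  | insert i S hi ih => rw [Finset.sum_insert hi, Finset.sum_insert hi, polyExpectation_add hξ, ih]

/-- Integration by parts for polynomials follows from its validity for monomials. -/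
theorem polyExpectation_X_mul_of_monomial [Fintype σ] (hξ : ∀ s, HasFiniteMoments P (ξ s))
    {s t : σ}
    (h : ∀ u : σ →₀ ℕ, ∫ ω, ∏ r, ξ r ω ^ (u + Finsupp.single s 1 : σ →₀ ℕ) r ∂P =
      u t * ∫ ω, ∏ r, ξ r ω ^ (u - Finsupp.single t 1 : σ →₀ ℕ) r ∂P) (p : MvPolynomial σ ℂ) :
    polyExpectation P ξ (MvPolynomial.X s * p) = polyExpectation P ξ (MvPolynomial.pderiv t p) := by
  induction p using MvPolynomial.induction_on' with
  | monomial u c =>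
    rw [MvPolynomial.pderiv_monomial, polyExpectation_monomial, MvPolynomial.X,
      MvPolynomial.monomial_mul, one_mul, add_comm, polyExpectation_monomial, h, mul_assoc]
  | add p q hp hq =>
    rw [mul_add, polyExpectation_add hξ, map_add, polyExpectation_add hξ, hp, hq]

end PolyExpectation

theorem integrable_pow_gaussianReal (n : ℕ) :
    Integrable (fun x : ℝ => x ^ n) (gaussianReal 0 1) := by
  have h := memLp_id_gaussianReal' (μ := 0) (v := 1) n (by simp)
  rcases Nat.eq_zero_or_pos n with rfl | hn
  · simp
  · have := h.integrable_norm_pow (by omega)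
    refine this.mono' (by fun_prop) (ae_of_all _ fun x => ?_)
    simp

/-- The derivative of `x ^ n` times the Gaussian density integrates to zero. For `n = 0` the
truncated exponent is harmless because of the factor `n`. -/
theorem integral_pow_succ_gaussianReal (n : ℕ) :
    ∫ x, x ^ (n + 1) ∂gaussianReal 0 1 = n * ∫ x, x ^ (n - 1) ∂gaussianReal 0 1 := by
  have hint : ∀ k : ℕ, Integrable (fun x : ℝ => gaussianPDFReal 0 1 x * x ^ k) := by
    intro k
    have h := integrable_pow_gaussianReal k
    rw [gaussianReal_of_var_ne_zero _ one_ne_zero, integrable_withDensity_iff_integrable_smul'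
      (measurable_gaussianPDF _ _) (ae_of_all _ fun _ => gaussianPDF_lt_top)] at h
    simpa [toReal_gaussianPDF] using h
  have hderiv : ∀ x, HasDerivAt (fun x : ℝ => gaussianPDFReal 0 1 x * x ^ n)
      (n * (gaussianPDFReal 0 1 x * x ^ (n - 1)) - gaussianPDFReal 0 1 x * x ^ (n + 1)) x := by
    intro x
    have h1 : HasDerivAt (gaussianPDFReal 0 1) (-x * gaussianPDFReal 0 1 x) x := by
      rw [gaussianPDFReal_def]
      have h2 : HasDerivAt (fun x : ℝ => -(x - 0) ^ 2 / (2 * ((1 : NNReal) : ℝ))) (-x) x := by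
        have := (((hasDerivAt_id x).sub_const 0).pow 2).neg.div_const (2 * ((1 : NNReal) : ℝ))
        refine this.congr_deriv ?_
        simp
        ring
      refine (h2.exp.const_mul _).congr_deriv ?_
      ring
    refine (h1.mul (hasDerivAt_pow n x)).congr_deriv ?_
    ring
  have h0 := integral_eq_zero_of_hasDerivAt_of_integrable hderiv
    (((hint (n - 1)).const_mul _).sub (hint (n + 1))) (hint n)
  rw [integral_sub ((hint (n - 1)).const_mul _) (hint (n + 1)), integral_const_mul, sub_eq_zero] at h0
  rw [integral_gaussianReal_eq_integral_smul one_ne_zero,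
    integral_gaussianReal_eq_integral_smul one_ne_zero]
  simpa using h0.symm

namespace ProbabilityTheory.HasLaw

variable {X : Ω → ℝ}

theorem hasFiniteMoments_of_gaussian (hX : HasLaw X (gaussianReal 0 1) P) :
    HasFiniteMoments P fun ω => (X ω : ℂ) := fun p => by
  have h := memLp_id_gaussianReal' (μ := 0) (v := 1) p (by simp)
  rw [← hX.map_eq] at h
  have := (memLp_map_measure_iff h.aestronglyMeasurable hX.aemeasurable).1 h
  exact this.ofReal

theorem integral_pow_succ_of_gaussian (hX : HasLaw X (gaussianReal 0 1) P) (n : ℕ) :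
    ∫ ω, (X ω : ℂ) ^ (n + 1) ∂P = n * ∫ ω, (X ω : ℂ) ^ (n - 1) ∂P := by
  have h : ∀ k : ℕ, ∫ ω, (X ω : ℂ) ^ k ∂P = ((∫ x, x ^ k ∂gaussianReal 0 1 : ℝ) : ℂ) := by
    intro k
    have := hX.integral_comp (f := fun x => x ^ k) (by fun_prop)
    rw [← this, ← integral_complex_ofReal]
    simp
  rw [h, h, integral_pow_succ_gaussianReal]
  push_cast
  rfl

end ProbabilityTheory.HasLaw

end Moments

/-! ### Integration by parts for a complex Gaussian. -/

section ComplexGaussian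

variable {Ω : Type*} [MeasurableSpace Ω] {P : Measure Ω} {X Y : Ω → ℝ}

/-- Gaussian integration by parts for a pair of independent standard Gaussians. -/
theorem polyExpectation_X_mul_of_indepFun [IsProbabilityMeasure P]
    (hX : HasLaw X (gaussianReal 0 1) P) (hY : HasLaw Y (gaussianReal 0 1) P)
    (h : IndepFun X Y P) (i : Fin 2) (p : MvPolynomial (Fin 2) ℂ) :
    polyExpectation P ![fun ω => (X ω : ℂ), fun ω => (Y ω : ℂ)] (MvPolynomial.X i * p) =
      polyExpectation P ![fun ω => (X ω : ℂ), fun ω => (Y ω : ℂ)] (MvPolynomial.pderiv i p) := by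
  have hfac : ∀ m n : ℕ, ∫ ω, (X ω : ℂ) ^ m * (Y ω : ℂ) ^ n ∂P =
      (∫ ω, (X ω : ℂ) ^ m ∂P) * ∫ ω, (Y ω : ℂ) ^ n ∂P := fun m n =>
    h.integral_fun_comp_mul_comp (X := X) (Y := Y) (f := fun x : ℝ => (x : ℂ) ^ m)
      (g := fun x : ℝ => (x : ℂ) ^ n)
      hX.aemeasurable hY.aemeasurable
      (by fun_prop) (by fun_prop)
  refine polyExpectation_X_mul_of_monomial ?_ (fun u => ?_) p
  · intro s
    fin_cases s
    · exact hX.hasFiniteMoments_of_gaussian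
    · exact hY.hasFiniteMoments_of_gaussian
  · fin_cases i
    · simp [Fin.prod_univ_two, hfac, hX.integral_pow_succ_of_gaussian, mul_assoc]
    · simp [Fin.prod_univ_two, hfac, hY.integral_pow_succ_of_gaussian, mul_left_comm]

theorem IsStdComplexGaussian.hasFiniteMoments [IsProbabilityMeasure P] {Z : Ω → ℂ}
    (hZ : IsStdComplexGaussian P Z) : HasFiniteMoments P Z := by
  obtain ⟨X, Y, hX, hY, -, h⟩ := hZ
  have h1 := ((HasFiniteMoments.const (P := P) Complex.I).mul hY.hasFiniteMoments_of_gaussian)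
  have h2 := (hX.hasFiniteMoments_of_gaussian.add h1).mul
    (HasFiniteMoments.const ((Real.sqrt 2 : ℂ)⁻¹))
  rw [show Z = _ from funext h]
  simpa only [div_eq_mul_inv] using h2

/-- With `Z` and its conjugate written as polynomials `z`, `w` in the real and imaginary Gaussians,
multiplication by `Z` becomes `c (∂₀ + i ∂₁)` under the expectation. As `c ^ 2 = 1/2`, this operator
kills `z` and sends `w` to 1: `Z` contracts only with its conjugate. -/
theorem IsStdComplexGaussian.integral_pow_succ_mul_conj_pow [IsProbabilityMeasure P] {Z : Ω → ℂ}
    (hZ : IsStdComplexGaussian P Z) (m n : ℕ) :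
    ∫ ω, Z ω ^ (m + 1) * (starRingEnd ℂ (Z ω)) ^ n ∂P =
      n * ∫ ω, Z ω ^ m * (starRingEnd ℂ (Z ω)) ^ (n - 1) ∂P := by
  obtain ⟨X, Y, hX, hY, hXY, hZ⟩ := hZ
  have ibp := polyExpectation_X_mul_of_indepFun hX hY hXY
  have hfin : ∀ s : Fin 2,
      HasFiniteMoments P ((![fun ω => (X ω : ℂ), fun ω => (Y ω : ℂ)] : Fin 2 → Ω → ℂ) s) := by
    intro s
    fin_cases s
    · exact hX.hasFiniteMoments_of_gaussian
    · exact hY.hasFiniteMoments_of_gaussian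
  set c : ℂ := (Real.sqrt 2 : ℂ)⁻¹ with hc
  have hc2 : 2 * c * c = 1 := by
    have h2 : (Real.sqrt 2 : ℂ) * (Real.sqrt 2 : ℂ) = 2 := by
      rw [← Complex.ofReal_mul, Real.mul_self_sqrt (by norm_num)]; norm_num
    rw [hc, mul_assoc, ← mul_inv, h2]; norm_num
  let z : MvPolynomial (Fin 2) ℂ :=
    MvPolynomial.C c * (MvPolynomial.X 0 + MvPolynomial.C Complex.I * MvPolynomial.X 1)
  let w : MvPolynomial (Fin 2) ℂ :=
    MvPolynomial.C c * (MvPolynomial.X 0 - MvPolynomial.C Complex.I * MvPolynomial.X 1)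
  have hz : ∀ ω, MvPolynomial.aeval (fun s : Fin 2 =>
      (![fun ω => (X ω : ℂ), fun ω => (Y ω : ℂ)] : Fin 2 → Ω → ℂ) s ω) z = Z ω := by
    intro ω
    simp [z, hZ ω, div_eq_inv_mul, hc]
  have hw : ∀ ω, MvPolynomial.aeval (fun s : Fin 2 =>
      (![fun ω => (X ω : ℂ), fun ω => (Y ω : ℂ)] : Fin 2 → Ω → ℂ) s ω) w =
        starRingEnd ℂ (Z ω) := by
    intro ω
    simp [w, hZ ω, div_eq_inv_mul, hc]
    ring
  have hE : ∀ m n : ℕ, ∫ ω, Z ω ^ m * (starRingEnd ℂ (Z ω)) ^ n ∂P =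
      polyExpectation P ![fun ω => (X ω : ℂ), fun ω => (Y ω : ℂ)] (z ^ m * w ^ n) := by
    intro m n
    simp only [polyExpectation, map_mul, map_pow, hz, hw]
  have hd0 : MvPolynomial.pderiv 0 (z ^ m * w ^ n) =
      MvPolynomial.C c * ((m : MvPolynomial (Fin 2) ℂ) * z ^ (m - 1) * w ^ n + (n : MvPolynomial (Fin 2) ℂ) * z ^ m * w ^ (n - 1)) := by
    simp [z, w]
    ring
  have hd1 : MvPolynomial.pderiv 1 (z ^ m * w ^ n) =
      MvPolynomial.C (c * Complex.I) * ((m : MvPolynomial (Fin 2) ℂ) * z ^ (m - 1) * w ^ n - (n : MvPolynomial (Fin 2) ℂ) * z ^ m * w ^ (n - 1)) := by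
    simp [z, w]
    ring
  have hsplit : z ^ (m + 1) * w ^ n = MvPolynomial.C c * (MvPolynomial.X 0 * (z ^ m * w ^ n)) +
      MvPolynomial.C (c * Complex.I) * (MvPolynomial.X 1 * (z ^ m * w ^ n)) := by
    rw [pow_succ, MvPolynomial.C_mul]
    conv_lhs => enter [1, 2]; simp only [z]
    ring
  rw [hE, hE, hsplit, polyExpectation_add hfin, polyExpectation_C_mul, polyExpectation_C_mul, ibp,
    ibp, ← polyExpectation_C_mul, ← polyExpectation_C_mul, ← polyExpectation_add hfin, hd0, hd1,
    ← polyExpectation_natCast_mul]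
  congr 1
  have hcc : MvPolynomial.C (σ := Fin 2) c * MvPolynomial.C c * 2 = 1 := by
    rw [← MvPolynomial.C_mul, show (2 : MvPolynomial (Fin 2) ℂ) = MvPolynomial.C 2 from (map_ofNat MvPolynomial.C 2).symm,
      ← MvPolynomial.C_mul, ← MvPolynomial.C_1]
    congr 1
    linear_combination hc2
  have hcI : MvPolynomial.C (σ := Fin 2) (c * Complex.I) * MvPolynomial.C (c * Complex.I) =
      -(MvPolynomial.C c * MvPolynomial.C c) := by
    rw [← MvPolynomial.C_mul, ← MvPolynomial.C_mul, ← map_neg]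
    congr 1
    linear_combination c * c * Complex.I_mul_I
  linear_combination
    ((n : MvPolynomial (Fin 2) ℂ) * z ^ m * w ^ (n - 1)) * hcc + ((m : MvPolynomial (Fin 2) ℂ) * z ^ (m - 1) * w ^ n - (n : MvPolynomial (Fin 2) ℂ) * z ^ m * w ^ (n - 1)) * hcI

theorem IsStdRealGaussian.hasFiniteMoments {Z : Ω → ℂ}
    (hZ : IsStdRealGaussian P Z) : HasFiniteMoments P Z := by
  obtain ⟨X, hX, h⟩ := hZ
  rw [show Z = _ from funext h]
  exact hX.hasFiniteMoments_of_gaussian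

theorem IsStdRealGaussian.integral_pow_succ {Z : Ω → ℂ} (hZ : IsStdRealGaussian P Z) (n : ℕ) :
    ∫ ω, Z ω ^ (n + 1) ∂P = n * ∫ ω, Z ω ^ (n - 1) ∂P := by
  obtain ⟨X, hX, h⟩ := hZ
  simp only [h]
  exact hX.integral_pow_succ_of_gaussian n

end ComplexGaussian

/-! ### Integration by parts for the matrix entries. -/

theorem prod_eq_prod_lower {N : ℕ} {M : Type*} [CommMonoid M] (F : Fin N × Fin N → M) :
    ∏ q, F q = ∏ p : {p : Fin N × Fin N // p.2 ≤ p.1},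
      F p.1 * (if p.1.1 = p.1.2 then 1 else F p.1.swap) := by
  rw [← Finset.prod_subtype (Finset.univ.filter fun q : Fin N × Fin N => q.2 ≤ q.1) (by simp)
      (fun q : Fin N × Fin N => F q * (if q.1 = q.2 then 1 else F q.swap)),
    Finset.prod_mul_distrib,
    ← Finset.prod_filter_mul_prod_filter_not Finset.univ (fun q : Fin N × Fin N => q.2 ≤ q.1) F]
  congr 1
  rw [Finset.prod_filter, Finset.prod_filter, ← (Equiv.prodComm (Fin N) (Fin N)).prod_comp]
  refine Finset.prod_congr rfl fun q _ => ?_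
  obtain ⟨i, j⟩ := q
  rcases lt_trichotomy i j with h | rfl | h
  · simp [h.le, not_le.2 h]
  · simp
  · simp [not_le.2 h, h.le, h.ne']

namespace IsUnnormalizedGUE

variable {Ω : Type*} [MeasurableSpace Ω] {P : Measure Ω} {N : ℕ}
  {a : Ω → Matrix (Fin N) (Fin N) ℂ}

theorem conj_apply (ha : IsUnnormalizedGUE P a) (ω : Ω) (i j : Fin N) :
    starRingEnd ℂ (a ω i j) = a ω j i := (ha.isHermitian ω).apply j i

variable [IsProbabilityMeasure P]

theorem hasFiniteMoments (ha : IsUnnormalizedGUE P a) (q : Fin N × Fin N) :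
    HasFiniteMoments P fun ω => a ω q.1 q.2 := by
  obtain ⟨i, j⟩ := q
  by_cases h : i = j
  · subst h; exact (ha.diag i).hasFiniteMoments
  · exact (ha.offDiag i j h).hasFiniteMoments

theorem integral_pow_succ_mul_pow (ha : IsUnnormalizedGUE P a) {i j : Fin N} (hij : i ≠ j)
    (m n : ℕ) : ∫ ω, a ω i j ^ (m + 1) * a ω j i ^ n ∂P =
      n * ∫ ω, a ω i j ^ m * a ω j i ^ (n - 1) ∂P := by
  simpa only [ha.conj_apply] using (ha.offDiag i j hij).integral_pow_succ_mul_conj_pow m n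

/-- Independence is available only on and below the diagonal. An entry above it is the conjugate of
its mirror image, so each mirror pair is a function of one independent variable. -/
theorem integral_prod_pow (ha : IsUnnormalizedGUE P a) (u : Fin N × Fin N → ℕ) :
    ∫ ω, ∏ q, a ω q.1 q.2 ^ u q ∂P = ∏ p : {p : Fin N × Fin N // p.2 ≤ p.1},
      ∫ ω, a ω p.1.1 p.1.2 ^ u p.1 *
        (if p.1.1 = p.1.2 then 1 else a ω p.1.2 p.1.1 ^ u p.1.swap) ∂P := by
  have h := ha.indep.integral_fun_prod_comp
    (f := fun p z => z ^ u p.1 * (if p.1.1 = p.1.2 then 1 else starRingEnd ℂ z ^ u p.1.swap))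
    (fun p => (ha.hasFiniteMoments p.1).aestronglyMeasurable.aemeasurable)
    (fun p => by
      refine Continuous.aestronglyMeasurable ?_
      split_ifs
      · fun_prop
      · exact (continuous_pow _).mul (Complex.continuous_conj.pow _))
  simp only [ha.conj_apply] at h
  rw [← h]
  refine integral_congr_ae (ae_of_all _ fun ω => ?_)
  exact prod_eq_prod_lower fun q => a ω q.1 q.2 ^ u q

/-- Gaussian integration by parts for the entries of a `GUE`. -/
theorem polyExpectation_X_mul (ha : IsUnnormalizedGUE P a) (i j : Fin N)
    (p : MvPolynomial (Fin N × Fin N) ℂ) :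
    polyExpectation P (fun q ω => a ω q.1 q.2) (MvPolynomial.X (i, j) * p) =
      polyExpectation P (fun q ω => a ω q.1 q.2) (MvPolynomial.pderiv (j, i) p) := by
  refine polyExpectation_X_mul_of_monomial ha.hasFiniteMoments (fun u => ?_) p
  rw [ha.integral_prod_pow, ha.integral_prod_pow]
  -- The independent entry carrying both `(i, j)` and `(j, i)`. Only its factor changes; there the
  -- claim is a one-variable identity.
  obtain ⟨r, hr⟩ : ∃ r : {p : Fin N × Fin N // p.2 ≤ p.1}, r.1 = (i, j) ∨ r.1 = (j, i) := by
    rcases le_total j i with h | h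
    · exact ⟨⟨(i, j), h⟩, Or.inl rfl⟩
    · exact ⟨⟨(j, i), h⟩, Or.inr rfl⟩
  rw [← Finset.mul_prod_erase _ _ (Finset.mem_univ r), ← Finset.mul_prod_erase _ _
    (Finset.mem_univ r), ← mul_assoc]
  congr 1
  · have h1 : ∀ k l : Fin N, (u + Finsupp.single (i, j) 1 : Fin N × Fin N →₀ ℕ) (k, l) =
        u (k, l) + if i = k ∧ j = l then 1 else 0 := by
      intro k l; simp [Finsupp.single_apply]
    have h2 : ∀ k l : Fin N, (u - Finsupp.single (j, i) 1 : Fin N × Fin N →₀ ℕ) (k, l) =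
        u (k, l) - if j = k ∧ i = l then 1 else 0 := by
      intro k l; simp [Finsupp.single_apply]
    by_cases hij : i = j
    · subst hij
      have hr : r.1 = (i, i) := by tauto
      simp only [hr, h1, h2, Prod.swap]
      simpa using (ha.diag i).integral_pow_succ (u (i, i))
    · have hji : ¬ j = i := fun h => hij h.symm
      have h3 := ha.integral_pow_succ_mul_pow hij (u (i, j)) (u (j, i))
      rcases hr with hr | hr
      · simp only [hr, h1, h2, Prod.swap]
        simpa [hij, hji] using h3
      · simp only [hr, h1, h2, Prod.swap]
        simpa [hij, hji, mul_comm] using h3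
  · refine Finset.prod_congr rfl fun s hs => ?_
    have hsr := Finset.ne_of_mem_erase hs
    obtain ⟨⟨k, l⟩, hkl⟩ := s
    have hne : (i, j) ≠ (k, l) ∧ (j, i) ≠ (k, l) := by
      obtain ⟨r, hr'⟩ := r
      simp only [Prod.mk.injEq, ne_eq, Subtype.mk.injEq] at *
      constructor <;> rintro ⟨rfl, rfl⟩ <;> rcases hr with rfl | rfl <;> simp at * <;>
        exact hsr (le_antisymm ‹_› ‹_›) (le_antisymm ‹_› ‹_›)
    have hne' : (i, j) ≠ (l, k) ∧ (j, i) ≠ (l, k) := by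
      simp only [Prod.mk.injEq, ne_eq] at *
      tauto
    simp [hne.1, hne.2, hne'.1, hne'.2]

end IsUnnormalizedGUE

/-! ### Derivatives of traces of the generic matrix. -/

section GenericMatrix

variable {N : ℕ}

/-- The matrix of independent commuting variables. -/
noncomputable def genericMatrix (N : ℕ) :
    Matrix (Fin N) (Fin N) (MvPolynomial (Fin N × Fin N) ℂ) :=
  Matrix.mvPolynomialX (Fin N) (Fin N) ℂ

theorem genericMatrix_apply (i j : Fin N) : genericMatrix N i j = MvPolynomial.X (i, j) := rfl

theorem Finset.sum_multiset_sum_map {ι κ M : Type*} [AddCommMonoid M] (S : Finset ι)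
    (s : Multiset κ) (f : ι → κ → M) :
    ∑ i ∈ S, (s.map (f i)).sum = (s.map fun m => ∑ i ∈ S, f i m).sum := by
  induction s using Multiset.induction_on with
  | empty => simp
  | cons a s ih => simp [Finset.sum_add_distrib, ih]

theorem pderiv_mvPolynomialX_pow_apply (i j : Fin N) (k : ℕ) (b c : Fin N) :
    MvPolynomial.pderiv (j, i) ((genericMatrix N ^ k) b c) =
      ∑ s ∈ Finset.range k, (genericMatrix N ^ s) b j * (genericMatrix N ^ (k - 1 - s)) i c := by
  induction k generalizing c with
  | zero => by_cases h : b = c <;> simp [Matrix.one_apply, h]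
  | succ k ih =>
    have h1 : ∀ d, MvPolynomial.pderiv (j, i) ((genericMatrix N ^ k) b d * genericMatrix N d c) =
        (∑ s ∈ Finset.range k, (genericMatrix N ^ s) b j * (genericMatrix N ^ (k - 1 - s)) i d) * genericMatrix N d c +
          if d = j ∧ c = i then (genericMatrix N ^ k) b d else 0 := by
      intro d
      rw [MvPolynomial.pderiv_mul, ih, genericMatrix_apply, MvPolynomial.pderiv_X]
      congr 1
      by_cases h : d = j ∧ c = i
      · rw [h.1, h.2]; simp
      · have : (d, c) ≠ (j, i) := by simpa using h
        simp [h]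
    rw [pow_succ, Matrix.mul_apply, map_sum, Finset.sum_congr rfl fun d _ => h1 d,
      Finset.sum_add_distrib, Finset.sum_range_succ]
    congr 1
    · simp_rw [Finset.sum_mul]
      rw [Finset.sum_comm]
      refine Finset.sum_congr rfl fun s hs => ?_
      have := Finset.mem_range.1 hs
      simp_rw [mul_assoc]
      rw [← Finset.mul_sum, show k + 1 - 1 - s = (k - 1 - s) + 1 by omega, pow_succ,
        Matrix.mul_apply]
    · by_cases h : c = i
      · subst h; simp
      · simp [h, Ne.symm h]

theorem pderiv_trace_mvPolynomialX_pow (i j : Fin N) (k : ℕ) :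
    MvPolynomial.pderiv (j, i) (genericMatrix N ^ k).trace = k * (genericMatrix N ^ (k - 1)) i j := by
  simp only [Matrix.trace, Matrix.diag_apply, map_sum, pderiv_mvPolynomialX_pow_apply]
  rw [Finset.sum_comm]
  have h : ∀ s ∈ Finset.range k, ∑ b, (genericMatrix N ^ s) b j * (genericMatrix N ^ (k - 1 - s)) i b =
      (genericMatrix N ^ (k - 1)) i j := by
    intro s hs
    have := Finset.mem_range.1 hs
    rw [show k - 1 = (k - 1 - s) + s by omega, pow_add, Matrix.mul_apply, Nat.add_sub_cancel]
    exact Finset.sum_congr rfl fun b _ => mul_comm _ _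
  rw [Finset.sum_congr rfl h]
  simp

theorem Derivation.leibniz_multiset_prod {R A ι : Type*} [CommRing R] [CommRing A] [Algebra R A]
    [DecidableEq ι] (D : Derivation R A A) (f : ι → A) (s : Multiset ι) :
    D (s.map f).prod = (s.map fun i => ((s.erase i).map f).prod * D (f i)).sum := by
  induction s using Multiset.induction_on with
  | empty => simp
  | cons a s ih =>
    rw [Multiset.map_cons, Multiset.prod_cons, D.leibniz, ih, Multiset.map_cons, Multiset.sum_cons,
      Multiset.erase_cons_head, smul_eq_mul, smul_eq_mul, add_comm, ← Multiset.sum_map_mul_left]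
    congr 2
    refine Multiset.map_congr rfl fun i hi => ?_
    by_cases h : i = a
    · subst h
      rw [Multiset.erase_cons_head, ← mul_assoc]
      congr 1
      rw [← Multiset.prod_cons, ← Multiset.map_cons, Multiset.cons_erase hi]
    · rw [Multiset.erase_cons_tail _ (Ne.symm h), Multiset.map_cons, Multiset.prod_cons, mul_assoc]

/-- The product of the traces of the powers `m ∈ s` of the generic matrix. -/
noncomputable def genericTraces (N : ℕ) (s : Multiset ℕ) : MvPolynomial (Fin N × Fin N) ℂ :=
  (s.map fun m => (genericMatrix N ^ m).trace).prod

theorem genericTraces_cons (m : ℕ) (s : Multiset ℕ) :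
    genericTraces N (m ::ₘ s) = (genericMatrix N ^ m).trace * genericTraces N s := by
  simp [genericTraces]

/-- Differentiating the matrix power cuts it at each position and leaves two closed traces (split).
Differentiating the trace of the `m`-th power gives `m` times an open power, which closes up with
the `k`-th one (merge). -/
theorem sum_pderiv_pow_mul_genericTraces (k : ℕ) (s : Multiset ℕ) :
    ∑ i, ∑ j, MvPolynomial.pderiv (j, i) ((genericMatrix N ^ k) j i * genericTraces N s) =
      ∑ j ∈ Finset.range k, genericTraces N (j ::ₘ (k - 1 - j) ::ₘ s) +
        (s.map fun m : ℕ => (m : MvPolynomial (Fin N × Fin N) ℂ) *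
          genericTraces N ((k + m - 1) ::ₘ s.erase m)).sum := by
  simp only [MvPolynomial.pderiv_mul, Finset.sum_add_distrib]
  congr 1
  · simp only [pderiv_mvPolynomialX_pow_apply, genericTraces_cons, ← mul_assoc, ← Finset.sum_mul]
    congr 1
    have : ∀ i, ∑ j, ∑ r ∈ Finset.range k, (genericMatrix N ^ r) j j * (genericMatrix N ^ (k - 1 - r)) i i =
        ∑ r ∈ Finset.range k, ∑ j, (genericMatrix N ^ r) j j * (genericMatrix N ^ (k - 1 - r)) i i :=
      fun i => Finset.sum_comm
    simp only [this]
    rw [Finset.sum_comm]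
    refine Finset.sum_congr rfl fun r _ => ?_
    simp only [Matrix.trace, Matrix.diag_apply]
    rw [Finset.sum_mul_sum, Finset.sum_comm]
  · have h1 : ∀ i j, (genericMatrix N ^ k) j i * MvPolynomial.pderiv (j, i) (genericTraces N s) =
        (s.map fun m : ℕ => (m : MvPolynomial (Fin N × Fin N) ℂ) *
          genericTraces N (s.erase m) * ((genericMatrix N ^ k) j i * (genericMatrix N ^ (m - 1)) i j)).sum := by
      intro i j
      rw [genericTraces, Derivation.leibniz_multiset_prod, ← Multiset.sum_map_mul_left]
      congr 1
      refine Multiset.map_congr rfl fun m _ => ?_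
      rw [pderiv_trace_mvPolynomialX_pow, genericTraces]
      ring
    simp only [h1, Finset.sum_multiset_sum_map]
    congr 1
    refine Multiset.map_congr rfl fun m _ => ?_
    rcases m with _ | m
    · simp
    simp only [← Finset.mul_sum]
    rw [genericTraces_cons, show k + (m + 1) - 1 = k + m by omega, pow_add, Finset.sum_comm,
      mul_assoc, mul_comm (genericTraces N _)]
    simp [Matrix.trace, Matrix.mul_apply]

theorem aeval_genericTraces (M : Matrix (Fin N) (Fin N) ℂ) (s : Multiset ℕ) :
    MvPolynomial.aeval (fun q : Fin N × Fin N => M q.1 q.2) (genericTraces N s) =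
      (s.map fun m => (M ^ m).trace).prod := by
  rw [genericTraces, map_multiset_prod, Multiset.map_map]
  congr 1
  refine Multiset.map_congr rfl fun m _ => ?_
  have h : (MvPolynomial.aeval (fun q : Fin N × Fin N => M q.1 q.2)).mapMatrix (genericMatrix N) = M :=
    Matrix.mvPolynomialX_mapMatrix_aeval ℂ M
  rw [Function.comp_apply, ← h, ← map_pow, h]
  simp [Matrix.trace]

end GenericMatrix

/-! ### Loop equations for the GUE. -/

section TraceMoments

variable {Ω : Type*} [MeasurableSpace Ω] {P : Measure Ω} {N : ℕ}

/-- The normalized trace of the `m`-th power of a (Hermitian) matrix. -/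
noncomputable def normTrace (M : Matrix (Fin N) (Fin N) ℂ) (m : ℕ) : ℝ := (M ^ m).trace.re / N

/-- The mixed moments of the normalized traces of the powers of a random matrix. -/
noncomputable def traceMoment (P : Measure Ω) (A : Ω → Matrix (Fin N) (Fin N) ℂ)
    (s : Multiset ℕ) : ℝ :=
  ∫ ω, (s.map fun m => normTrace (A ω) m).prod ∂P

theorem Matrix.IsHermitian.ofReal_re_trace {M : Matrix (Fin N) (Fin N) ℂ} (hM : M.IsHermitian) :
    (M.trace.re : ℂ) = M.trace := by
  have h : star M.trace = M.trace := by rw [← Matrix.trace_conjTranspose, hM]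
  exact Complex.conj_eq_iff_re.1 h

theorem ofReal_prod_normTrace {M : Matrix (Fin N) (Fin N) ℂ} (hM : M.IsHermitian)
    (s : Multiset ℕ) :
    (((s.map fun m => normTrace ((1 / (Real.sqrt N : ℂ)) • M) m).prod : ℝ) : ℂ) =
      ((N : ℂ) ^ s.card * (Real.sqrt N : ℂ) ^ s.sum)⁻¹ *
        MvPolynomial.aeval (fun q : Fin N × Fin N => M q.1 q.2) (genericTraces N s) := by
  rw [aeval_genericTraces]
  induction s using Multiset.induction_on with
  | empty => simp
  | cons m s ih =>
    have h : (normTrace ((1 / (Real.sqrt N : ℂ)) • M) m : ℂ) =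
        ((N : ℂ) * (Real.sqrt N : ℂ) ^ m)⁻¹ * (M ^ m).trace := by
      have h1 : ((1 / (Real.sqrt N : ℂ)) • M) ^ m = (((Real.sqrt N ^ m)⁻¹ : ℝ) : ℂ) • M ^ m := by
        rw [smul_pow]; simp
      rw [normTrace, h1, Matrix.trace_smul, smul_eq_mul, Complex.re_ofReal_mul, ←
        (hM.pow m).ofReal_re_trace]
      push_cast
      rw [Complex.ofReal_re, mul_inv]
      ring
    rw [Multiset.map_cons, Multiset.prod_cons, Complex.ofReal_mul, h, ih, Multiset.map_cons,
      Multiset.prod_cons, Multiset.card_cons, Multiset.sum_cons, pow_succ, pow_add]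
    simp only [mul_inv]
    ring

theorem polyExpectation_multiset_sum [IsFiniteMeasure P] {σ : Type*} {ξ : σ → Ω → ℂ}
    (hξ : ∀ s, HasFiniteMoments P (ξ s)) {ι : Type*} (s : Multiset ι)
    (p : ι → MvPolynomial σ ℂ) :
    polyExpectation P ξ (s.map p).sum = (s.map fun i => polyExpectation P ξ (p i)).sum := by
  induction s using Multiset.induction_on with
  | empty => simp [polyExpectation_zero]
  | cons i s ih => simp [polyExpectation_add hξ, ih]

variable {A : Ω → Matrix (Fin N) (Fin N) ℂ}

theorem IsUnnormalizedGUE.ofReal_traceMoment {a : Ω → Matrix (Fin N) (Fin N) ℂ}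
    (ha : IsUnnormalizedGUE P a) (s : Multiset ℕ) :
    (traceMoment P (fun ω => (1 / (Real.sqrt N : ℂ)) • a ω) s : ℂ) =
      ((N : ℂ) ^ s.card * (Real.sqrt N : ℂ) ^ s.sum)⁻¹ *
        polyExpectation P (fun q ω => a ω q.1 q.2) (genericTraces N s) := by
  rw [traceMoment, ← integral_complex_ofReal, polyExpectation, ← integral_const_mul]
  exact integral_congr_ae (ae_of_all _ fun ω => ofReal_prod_normTrace (ha.isHermitian ω) s)

theorem IsGUE.isHermitian (hA : IsGUE P A) (ω : Ω) : (A ω).IsHermitian := by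
  obtain ⟨a, ha, h⟩ := hA
  rw [h]
  refine (ha.isHermitian ω).smul ?_
  rw [isSelfAdjoint_iff]
  simp

variable [IsProbabilityMeasure P]

theorem IsUnnormalizedGUE.polyExpectation_genericTraces_cons {a : Ω → Matrix (Fin N) (Fin N) ℂ}
    (ha : IsUnnormalizedGUE P a) (k : ℕ) (s : Multiset ℕ) :
    polyExpectation P (fun q ω => a ω q.1 q.2) (genericTraces N ((k + 1) ::ₘ s)) =
      ∑ j ∈ Finset.range k, polyExpectation P (fun q ω => a ω q.1 q.2)
        (genericTraces N (j ::ₘ (k - 1 - j) ::ₘ s)) +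
      (s.map fun m : ℕ => (m : ℂ) * polyExpectation P (fun q ω => a ω q.1 q.2)
        (genericTraces N ((k + m - 1) ::ₘ s.erase m))).sum := by
  have h1 : genericTraces N ((k + 1) ::ₘ s) =
      ∑ i, ∑ j, MvPolynomial.X (i, j) * ((genericMatrix N ^ k) j i * genericTraces N s) := by
    rw [genericTraces_cons, pow_succ', Matrix.trace, Finset.sum_mul]
    refine Finset.sum_congr rfl fun i _ => ?_
    rw [Matrix.diag_apply, Matrix.mul_apply, Finset.sum_mul]
    refine Finset.sum_congr rfl fun j _ => ?_
    rw [genericMatrix_apply, mul_assoc]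
  have hfin := ha.hasFiniteMoments
  rw [h1, polyExpectation_sum hfin]
  simp only [polyExpectation_sum hfin, ha.polyExpectation_X_mul]
  rw [← polyExpectation_sum hfin, ← Finset.sum_congr rfl fun i _ => polyExpectation_sum hfin
    Finset.univ fun j => MvPolynomial.pderiv (j, i) ((genericMatrix N ^ k) j i * genericTraces N s),
    ← polyExpectation_sum hfin, sum_pderiv_pow_mul_genericTraces, polyExpectation_add hfin,
    polyExpectation_sum hfin, polyExpectation_multiset_sum hfin]
  simp only [polyExpectation_natCast_mul]

theorem IsGUE.integrable_prod_normTrace (hA : IsGUE P A) (s : Multiset ℕ) :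
    Integrable (fun ω => (s.map fun m => normTrace (A ω) m).prod) P := by
  obtain ⟨a, ha, h⟩ := hA
  have h1 := ((HasFiniteMoments.aeval ha.hasFiniteMoments (genericTraces N s)).integrable.const_mul
    ((N : ℂ) ^ s.card * (Real.sqrt N : ℂ) ^ s.sum)⁻¹).re
  refine h1.congr (ae_of_all _ fun ω => ?_)
  have h2 := ofReal_prod_normTrace (ha.isHermitian ω) s
  rw [← h ω] at h2
  exact (congrArg RCLike.re h2.symm).trans (Complex.ofReal_re _)

/-- The loop equations for the `GUE`. -/
theorem IsGUE.loopSystem (hN : 1 ≤ N) (hA : IsGUE P A) :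
    LoopSystem (((N : ℝ) ^ 2)⁻¹) (traceMoment P A) := by
  have hN0 : (N : ℝ) ≠ 0 := by positivity
  refine ⟨by simp [traceMoment], fun s => ?_, fun k s => ?_⟩
  · simp [traceMoment, normTrace, hN0]
  obtain ⟨a, ha, h⟩ := hA
  obtain rfl : A = fun ω => (1 / (Real.sqrt N : ℂ)) • a ω := funext h
  have hNc : (N : ℂ) ≠ 0 := by exact_mod_cast hN0
  have hr : (Real.sqrt N : ℂ) ^ 2 = N := by
    rw [← Complex.ofReal_pow, Real.sq_sqrt (by positivity)]; simp
  have hr0 : (Real.sqrt N : ℂ) ≠ 0 := by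
    intro h0; rw [h0] at hr; exact hNc (by simpa using hr.symm)
  have hmap : ∀ f : ℕ → ℝ, (((s.map f).sum : ℝ) : ℂ) = (s.map fun m => (f m : ℂ)).sum := by
    intro f
    exact (map_multiset_sum Complex.ofRealHom _).trans (by rw [Multiset.map_map]; rfl)
  rw [← Complex.ofReal_inj]
  push_cast
  rw [hmap]
  push_cast
  simp only [ha.ofReal_traceMoment]
  rw [ha.polyExpectation_genericTraces_cons, mul_add, Finset.mul_sum, ← Multiset.sum_map_mul_left,
    ← Multiset.sum_map_mul_left]
  congr 1
  -- Split: one more trace, degree lower by two; the powers of `N` cancel.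
  · refine Finset.sum_congr rfl fun j hj => ?_
    have := Finset.mem_range.1 hj
    congr 2
    simp only [Multiset.card_cons, Multiset.sum_cons]
    rw [show k + 1 + s.sum = (j + (k - 1 - j + s.sum)) + 2 by omega, pow_add _ _ 2, hr]
    ring
  -- Merge: one trace fewer and degree lower by two, leaving `N⁻²`.
  · congr 1
    refine Multiset.map_congr rfl fun m hm => ?_
    rcases Nat.eq_zero_or_pos m with rfl | hm0
    · simp
    simp only [Multiset.card_cons, Multiset.sum_cons, Multiset.card_erase_of_mem hm]
    have h1 := Multiset.sum_erase hm
    have h2 : 0 < s.card := Multiset.card_pos_iff_exists_mem.2 ⟨m, hm⟩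
    rw [show k + 1 + s.sum = (k + m - 1 + (s.erase m).sum) + 2 by omega, pow_add _ _ 2, hr,
      show s.card.pred + 1 = s.card by simp; omega]
    field_simp
    ring

end TraceMoments

/-! ### From trace moments to a lower bound for the largest eigenvalue. -/

section Deterministic

variable {N : ℕ} {M : Matrix (Fin N) (Fin N) ℂ}

theorem normTrace_eq_sum_eigenvalues (hM : M.IsHermitian) (m : ℕ) :
    normTrace M m = (∑ i, hM.eigenvalues i ^ m) / N := by
  have h : (M ^ m).trace = ((∑ i, hM.eigenvalues i ^ m : ℝ) : ℂ) := by
    conv_lhs => rw [hM.spectral_theorem, ← map_pow, Matrix.diagonal_pow,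
      Unitary.conjStarAlgAut_apply, Matrix.trace_mul_comm, ← mul_assoc]
    simp [Matrix.trace_diagonal]
  rw [normTrace, h, Complex.ofReal_re]

theorem sum_choose_mul_normTrace (hM : M.IsHermitian) (c : ℝ) (n : ℕ) :
    ∑ k ∈ Finset.range (n + 1), c ^ (n - k) * n.choose k * normTrace M k =
      (∑ i, (hM.eigenvalues i + c) ^ n) / N := by
  simp only [normTrace_eq_sum_eigenvalues hM, add_pow, Finset.sum_div, Finset.mul_sum]
  rw [Finset.sum_comm]
  refine Finset.sum_congr rfl fun i _ => Finset.sum_congr rfl fun k _ => ?_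
  ring

/-- Up to a polynomial factor, semicircle moments dominate those of point masses at `±2`: the
semicircle law reaches its edges. -/
theorem pow_add_neg_pow_le_semicircleMoment {k n : ℕ} (hk : k ≤ n) :
    2 ^ k + (-2) ^ k ≤ 2 * ((n : ℝ) + 1) ^ 2 * semicircleMoment k := by
  obtain ⟨a, rfl | rfl⟩ := k.even_or_odd'
  · rw [pow_mul, pow_mul, semicircleMoment_two_mul]
    have h : (4 : ℝ) ^ a ≤ (2 * a + 1) * (a + 1) * catalan a := by
      exact_mod_cast four_pow_le_mul_catalan a
    have hn : (2 * a : ℝ) ≤ n := by exact_mod_cast hk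
    have ha : (0 : ℝ) ≤ a := a.cast_nonneg
    have h2 : ((2 * a + 1) * (a + 1) : ℝ) * catalan a ≤ ((n : ℝ) + 1) ^ 2 * catalan a :=
      mul_le_mul_of_nonneg_right (by nlinarith) (by positivity)
    norm_num
    linarith
  · rw [semicircleMoment_two_mul_add_one, pow_succ, pow_succ, pow_mul, pow_mul]
    norm_num

/-- The test function `(x + 3) ^ n` is nonnegative and nondecreasing on `[-3, ∞)`. If no eigenvalue
exceeds `2 - ε`, its spectral average is at most `(5 - ε) ^ n`, while its semicircle average is at
least `5 ^ n` over a polynomial in `n`. For large `n` these are incompatible, even after small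
errors in the moments. -/
theorem exists_moment_bound_imp_lt_largestEigenvalue {ε : ℝ} (hε : 0 < ε) (hε1 : ε ≤ 1) :
    ∃ (n : ℕ) (θ : ℝ), 0 < θ ∧ ∀ (N : ℕ) (M : Matrix (Fin N) (Fin N) ℂ) (hM : M.IsHermitian),
      1 ≤ N → (∀ i, -3 ≤ hM.eigenvalues i) →
      (∀ k ≤ n, semicircleMoment k - θ ≤ normTrace M k) → 2 - ε < largestEigenvalue M := by
  obtain ⟨n, hn⟩ : ∃ n : ℕ, 4 * ((n : ℝ) + 1) ^ 2 * (5 - ε) ^ n < 5 ^ n := by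
    have hr : |(5 - ε) / 5| < 1 := by
      rw [abs_lt]; constructor <;> linarith
    have h := (tendsto_add_atTop_iff_nat 1).2
      (tendsto_pow_const_mul_const_pow_of_abs_lt_one 2 hr)
    obtain ⟨n, hn⟩ := (h.eventually (gt_mem_nhds (show (0 : ℝ) < (5 - ε) / 5 / 4 by linarith))).exists
    refine ⟨n, ?_⟩
    have hr0 : 0 < (5 - ε) / 5 := by linarith
    push_cast at hn
    rw [pow_succ ((5 - ε) / 5), ← mul_assoc, div_eq_mul_inv ((5 - ε) / 5) 4,
      mul_comm ((5 - ε) / 5) 4⁻¹] at hn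
    have h2 := lt_of_mul_lt_mul_right hn hr0.le
    rw [div_pow, ← mul_div_assoc, div_lt_iff₀ (by positivity)] at h2
    linarith
  have hn1 : 0 < 4 * ((n : ℝ) + 1) ^ 2 := by positivity
  -- The coefficients of `(x + 3) ^ n` sum to `4 ^ n`, so moment errors `θ` cost at most half of the
  -- lower bound `5 ^ n / (2 (n + 1) ^ 2)`.
  set θ : ℝ := 5 ^ n / (4 * ((n : ℝ) + 1) ^ 2) / 4 ^ n with hθ
  refine ⟨n, θ, by positivity, fun N M hM hN hlow hmom => ?_⟩
  by_contra! hcon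
  have hN0 : (0 : ℝ) < N := by exact_mod_cast hN
  have hgr := isGreatest_largestEigenvalue hN hM
  have hupper : (∑ i, (hM.eigenvalues i + 3) ^ n) / N ≤ (5 - ε) ^ n := by
    rw [div_le_iff₀ hN0]
    have : ∀ i ∈ Finset.univ, (hM.eigenvalues i + 3) ^ n ≤ (5 - ε) ^ n := by
      intro i _
      have h1 := hgr.2 ⟨i, rfl⟩
      exact pow_le_pow_left₀ (by linarith [hlow i]) (by linarith) n
    refine (Finset.sum_le_sum this).trans (le_of_eq ?_)
    simp [mul_comm]
  rw [← sum_choose_mul_normTrace hM] at hupper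
  have h4 : ∑ k ∈ Finset.range (n + 1), (3 : ℝ) ^ (n - k) * n.choose k = 4 ^ n := by
    have := add_pow (1 : ℝ) 3 n
    norm_num at this
    exact this.symm
  have h5 : ∑ k ∈ Finset.range (n + 1), (3 : ℝ) ^ (n - k) * n.choose k * (2 ^ k + (-2) ^ k) =
      5 ^ n + 1 := by
    have e1 := add_pow (2 : ℝ) 3 n
    have e2 := add_pow (-2 : ℝ) 3 n
    norm_num at e1 e2
    rw [(congrArg₂ (· + ·) e1 e2 : (5 : ℝ) ^ n + 1 = _ + _), ← Finset.sum_add_distrib]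
    exact Finset.sum_congr rfl fun k _ => by ring
  have h6 : ∑ k ∈ Finset.range (n + 1), (3 : ℝ) ^ (n - k) * n.choose k * semicircleMoment k -
      θ * 4 ^ n ≤ ∑ k ∈ Finset.range (n + 1), (3 : ℝ) ^ (n - k) * n.choose k * normTrace M k := by
    rw [← h4, Finset.mul_sum, ← Finset.sum_sub_distrib]
    refine Finset.sum_le_sum fun k hk => ?_
    have := hmom k (Nat.lt_succ_iff.1 (Finset.mem_range.1 hk))
    have h0 : (0 : ℝ) ≤ 3 ^ (n - k) * n.choose k := by positivity
    nlinarith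
  have h7 : (5 : ℝ) ^ n + 1 ≤ 2 * ((n : ℝ) + 1) ^ 2 *
      ∑ k ∈ Finset.range (n + 1), (3 : ℝ) ^ (n - k) * n.choose k * semicircleMoment k := by
    rw [← h5, Finset.mul_sum]
    refine Finset.sum_le_sum fun k hk => ?_
    have := pow_add_neg_pow_le_semicircleMoment (Nat.lt_succ_iff.1 (Finset.mem_range.1 hk))
    have h0 : (0 : ℝ) ≤ 3 ^ (n - k) * n.choose k := by positivity
    nlinarith
  have h8 : 4 * ((n : ℝ) + 1) ^ 2 * (θ * 4 ^ n) = 5 ^ n := by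
    rw [hθ]; field_simp
  nlinarith

end Deterministic

/-! ### Markov and Chebyshev bounds. -/

section Tails

variable {Ω : Type*} [MeasurableSpace Ω] {P : Measure Ω} [IsProbabilityMeasure P] {N : ℕ}
  {A : Ω → Matrix (Fin N) (Fin N) ℂ}

/-- Markov's inequality, since a single eigenvalue to the power `2k` is at most `N` times the
normalized trace of that power. -/
theorem measureReal_exists_le_abs_eigenvalues_le (hN : 1 ≤ N) (hA : IsGUE P A) {t : ℝ}
    (ht : 0 < t) (k : ℕ) :
    P.real {ω | ∃ i, t ≤ |(hA.isHermitian ω).eigenvalues i|} ≤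
      N * traceMoment P A {2 * k} / (t ^ 2) ^ k := by
  have hN0 : (0 : ℝ) < N := by exact_mod_cast hN
  have hnn : ∀ ω, 0 ≤ normTrace (A ω) (2 * k) := fun ω => by
    rw [normTrace_eq_sum_eigenvalues (hA.isHermitian ω)]
    exact div_nonneg (Finset.sum_nonneg fun i _ => (even_two_mul k).pow_nonneg _) hN0.le
  have hint : Integrable (fun ω => normTrace (A ω) (2 * k)) P := by
    simpa using hA.integrable_prod_normTrace {2 * k}
  have hmarkov := mul_meas_ge_le_integral_of_nonneg (ae_of_all P hnn) hint ((t ^ 2) ^ k / N)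
  have hsub : {ω | ∃ i, t ≤ |(hA.isHermitian ω).eigenvalues i|} ⊆
      {ω | (t ^ 2) ^ k / N ≤ normTrace (A ω) (2 * k)} := by
    rintro ω ⟨i, hi⟩
    rw [Set.mem_ofPred_eq, normTrace_eq_sum_eigenvalues (hA.isHermitian ω)]
    gcongr
    calc (t ^ 2) ^ k ≤ (|(hA.isHermitian ω).eigenvalues i| ^ 2) ^ k := by gcongr
      _ = (hA.isHermitian ω).eigenvalues i ^ (2 * k) := by rw [sq_abs, pow_mul]
      _ ≤ _ := Finset.single_le_sum (f := fun i => (hA.isHermitian ω).eigenvalues i ^ (2 * k))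
        (fun i _ => (even_two_mul k).pow_nonneg _) (Finset.mem_univ i)
  have hT : traceMoment P A {2 * k} = ∫ ω, normTrace (A ω) (2 * k) ∂P := by
    simp [traceMoment]
  rw [hT, le_div_iff₀ (by positivity)]
  have := measureReal_mono (μ := P) hsub
  rw [div_mul_eq_mul_div, div_le_iff₀ hN0] at hmarkov
  calc _ ≤ P.real {ω | (t ^ 2) ^ k / N ≤ normTrace (A ω) (2 * k)} * (t ^ 2) ^ k := by gcongr
    _ ≤ _ := by linarith

theorem exists_measureReal_le_abs_normTrace_sub_le (k : ℕ) :
    ∃ C : ℝ, ∀ {Ω : Type*} [MeasurableSpace Ω] {P : Measure Ω} [IsProbabilityMeasure P] {N : ℕ}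
      {A : Ω → Matrix (Fin N) (Fin N) ℂ}, 1 ≤ N → IsGUE P A → ∀ θ : ℝ, 0 < θ →
      P.real {ω | θ ≤ |normTrace (A ω) k - semicircleMoment k|} ≤
        C / θ ^ 2 * ((N : ℝ) ^ 2)⁻¹ := by
  obtain ⟨C, hC⟩ := LoopSystem.exists_le_add_mul {k, k}
  refine ⟨C, fun {Ω} _ {P} _ {N} {A} hN hA θ hθ => ?_⟩
  have hN1 : (1 : ℝ) ≤ N := by exact_mod_cast hN
  have hx0 : 0 ≤ ((N : ℝ) ^ 2)⁻¹ := by positivity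
  have hx1 : ((N : ℝ) ^ 2)⁻¹ ≤ 1 := inv_le_one_of_one_le₀ (one_le_pow₀ hN1)
  have hloop := hA.loopSystem hN
  have h1 := hC _ _ hloop hx0 hx1
  have h2 := hloop.prod_semicircleMoment_le hx0 {k}
  have hi1 : Integrable (fun ω => normTrace (A ω) k) P := by
    simpa using hA.integrable_prod_normTrace {k}
  have hi2 : Integrable (fun ω => normTrace (A ω) k * normTrace (A ω) k) P := by
    simpa using hA.integrable_prod_normTrace {k, k}
  have hexp : ∀ ω, (normTrace (A ω) k - semicircleMoment k) ^ 2 =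
      normTrace (A ω) k * normTrace (A ω) k - 2 * semicircleMoment k * normTrace (A ω) k +
        semicircleMoment k ^ 2 := fun ω => by ring
  have hi4 : Integrable (fun ω => normTrace (A ω) k * normTrace (A ω) k -
      2 * semicircleMoment k * normTrace (A ω) k) P := hi2.sub (hi1.const_mul _)
  have hi3 : Integrable (fun ω => (normTrace (A ω) k - semicircleMoment k) ^ 2) P := by
    simp only [hexp]
    exact hi4.add (integrable_const _)
  have hvar : ∫ ω, (normTrace (A ω) k - semicircleMoment k) ^ 2 ∂P =
      traceMoment P A {k, k} - 2 * semicircleMoment k * traceMoment P A {k} +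
        semicircleMoment k ^ 2 := by
    simp only [hexp]
    rw [integral_add hi4 (integrable_const _),
      integral_sub hi2 (hi1.const_mul _), integral_const_mul]
    simp [traceMoment]
  have hmarkov := mul_meas_ge_le_integral_of_nonneg
    (ae_of_all P fun ω => sq_nonneg (normTrace (A ω) k - semicircleMoment k)) hi3 (θ ^ 2)
  have hset : {ω | θ ≤ |normTrace (A ω) k - semicircleMoment k|} =
      {ω | θ ^ 2 ≤ (normTrace (A ω) k - semicircleMoment k) ^ 2} := by
    ext ω
    simp only [Set.mem_ofPred_eq]
    rw [← sq_abs (normTrace (A ω) k - semicircleMoment k), sq_le_sq₀ hθ.le (abs_nonneg _)]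
  rw [hset, div_mul_eq_mul_div, le_div_iff₀ (by positivity), mul_comm]
  refine hmarkov.trans ?_
  rw [hvar]
  simp only [Multiset.insert_eq_cons, Multiset.map_cons, Multiset.map_singleton,
    Multiset.prod_cons, Multiset.prod_singleton] at h1 h2 ⊢
  -- The upper bound on `T {k, k}` and the lower bound on `T {k}`, which enters with a nonpositive
  -- coefficient, cancel the main terms and leave `C * x`.
  nlinarith [semicircleMoment_nonneg k]

end Tails

/-! ### Moments of logarithmic degree and summable tails. -/

theorem eventually_pow_log_mul_inv_sq_le (m : ℕ) {c : ℝ} (hc : 0 < c) :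
    ∀ᶠ N : ℕ in atTop,
      ((N : ℝ) ^ 2)⁻¹ * (((2 * (m * Nat.log 2 N) : ℕ) : ℝ) + 1) ^ 8 ≤ c := by
  have hlog : Tendsto (Nat.log 2) atTop atTop := by
    refine tendsto_atTop_atTop.2 fun b => ⟨2 ^ b, fun a ha => ?_⟩
    exact Nat.le_log_of_pow_le (by norm_num) ha
  have h1 : Tendsto (fun L : ℕ => (2 * (m : ℝ) + 1) ^ 8 * ((L : ℝ) ^ 8 / 4 ^ L)) atTop (𝓝 0) := by
    simpa using (tendsto_pow_const_div_const_pow_of_one_lt 8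
      (show (1 : ℝ) < 4 by norm_num)).const_mul ((2 * (m : ℝ) + 1) ^ 8)
  filter_upwards [hlog.eventually (h1.eventually (ge_mem_nhds hc)),
    hlog.eventually (eventually_ge_atTop 1), eventually_ge_atTop 1] with N hN hL hN1
  refine le_trans ?_ hN
  set L := Nat.log 2 N with hLdef
  have h2 : (2 : ℝ) ^ L ≤ N := by
    exact_mod_cast Nat.pow_log_le_self 2 (by omega)
  have h4 : (4 : ℝ) ^ L ≤ (N : ℝ) ^ 2 := by
    calc (4 : ℝ) ^ L = (2 ^ L) ^ 2 := by rw [← pow_mul, mul_comm, pow_mul]; norm_num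
      _ ≤ _ := by gcongr
  have hL1 : (1 : ℝ) ≤ L := by exact_mod_cast hL
  have h5 : (((2 * (m * L) : ℕ) : ℝ) + 1) ≤ (2 * (m : ℝ) + 1) * L := by
    push_cast; nlinarith
  calc ((N : ℝ) ^ 2)⁻¹ * (((2 * (m * L) : ℕ) : ℝ) + 1) ^ 8
      ≤ ((4 : ℝ) ^ L)⁻¹ * ((2 * (m : ℝ) + 1) * L) ^ 8 := by gcongr
    _ = _ := by rw [mul_pow]; ring

theorem natCast_mul_inv_sixteen_pow_log_le {N : ℕ} (hN : 1 ≤ N) :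
    (N : ℝ) * (1 / 16) ^ Nat.log 2 N ≤ 16 * ((N : ℝ) ^ 2)⁻¹ := by
  have h1 : (N : ℝ) ≤ 2 * 2 ^ Nat.log 2 N := by
    have := Nat.lt_pow_succ_log_self (b := 2) (by norm_num) N
    rw [pow_succ] at this
    exact_mod_cast (by omega : N ≤ 2 * 2 ^ Nat.log 2 N)
  have hN1 : (1 : ℝ) ≤ N := by exact_mod_cast hN
  have h2 : (N : ℝ) ^ 4 ≤ 16 * 16 ^ Nat.log 2 N := by
    calc (N : ℝ) ^ 4 ≤ (2 * 2 ^ Nat.log 2 N) ^ 4 := by gcongr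
      _ = _ := by
        rw [mul_pow, ← pow_mul, mul_comm (Nat.log 2 N) 4, pow_mul]; norm_num
  have h3 : (N : ℝ) ^ 3 ≤ (N : ℝ) ^ 4 := pow_le_pow_right₀ hN1 (by norm_num)
  rw [one_div, inv_pow, ← div_eq_mul_inv, ← div_eq_mul_inv, div_le_div_iff₀ (by positivity)
    (by positivity)]
  linarith [show (N : ℝ) * (N : ℝ) ^ 2 = (N : ℝ) ^ 3 by ring]

theorem exists_summable_measureReal_eigenvalues {ε : ℝ} (hε : 0 < ε) :
    ∃ b : ℕ → ℝ, Summable b ∧ ∀ {Ω : Type*} [MeasurableSpace Ω] {P : Measure Ω}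
      [IsProbabilityMeasure P] {N : ℕ} {A : Ω → Matrix (Fin N) (Fin N) ℂ}, 1 ≤ N →
      ∀ hA : IsGUE P A,
        P.real {ω | ∃ i, 2 + ε ≤ |(hA.isHermitian ω).eigenvalues i|} ≤ b N := by
  -- Then `4(1 + 2η) ≤ 4 + 2ε < (2 + ε) ^ 2`, so each moment order gains a factor `q < 1`.
  set η : ℝ := min 1 (ε / 4) with hη
  have hη0 : 0 < η := by positivity
  have hη1 : η ≤ 1 := min_le_left _ _
  have hηε : 4 * η ≤ ε := by linarith [min_le_right 1 (ε / 4)]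
  set q : ℝ := 4 * (1 + 2 * η) / (2 + ε) ^ 2 with hq
  have hq0 : 0 ≤ q := by positivity
  have hq1 : q < 1 := by
    rw [hq, div_lt_one (by positivity)]; nlinarith
  -- With moment order `m * Nat.log 2 N`, the decay `16 ^ (-log₂ N)` beats the factor `N` from
  -- Markov and is still summable.
  obtain ⟨m, hm⟩ := exists_pow_lt_of_lt_one (show (0 : ℝ) < 1 / 16 by norm_num) hq1
  have hev := eventually_pow_log_mul_inv_sq_le m
    (show 0 < η ^ 2 / (1 + 2 * η) by positivity)
  obtain ⟨N₀, hN₀⟩ := eventually_atTop.1 hev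
  refine ⟨fun N => if N < N₀ then 1 else 16 * ((N : ℝ) ^ 2)⁻¹, ?_, ?_⟩
  · rw [← summable_nat_add_iff N₀]
    have h : Summable fun N : ℕ => 16 * ((N : ℝ) ^ 2)⁻¹ :=
      (Real.summable_nat_pow_inv.2 (by norm_num)).mul_left 16
    refine ((summable_nat_add_iff N₀).2 h).congr fun N => ?_
    simp
  · intro Ω _ P _ N A hN hA
    beta_reduce
    split_ifs with h
    · exact measureReal_le_one
    · have hcond := hN₀ N (not_lt.1 h)
      rw [le_div_iff₀ (by positivity)] at hcond
      have hT := (hA.loopSystem hN).apply_singleton_le (by positivity) hη0 hη1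
        (le_refl (2 * (m * Nat.log 2 N))) hcond
      refine (measureReal_exists_le_abs_eigenvalues_le hN hA (t := 2 + ε) (by linarith)
        (m * Nat.log 2 N)).trans ?_
      calc _ ≤ N * (4 * (1 + 2 * η)) ^ (m * Nat.log 2 N) /
            ((2 + ε) ^ 2) ^ (m * Nat.log 2 N) := by gcongr
        _ = N * (q ^ m) ^ Nat.log 2 N := by rw [mul_div_assoc, ← div_pow, ← pow_mul]
        _ ≤ N * (1 / 16) ^ Nat.log 2 N := by gcongr
        _ ≤ _ := natCast_mul_inv_sixteen_pow_log_le hN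

theorem exists_summable_measureReal_largestEigenvalue {ε : ℝ} (hε : 0 < ε) :
    ∃ b : ℕ → ℝ, Summable b ∧ ∀ {Ω : Type*} [MeasurableSpace Ω] {P : Measure Ω}
      [IsProbabilityMeasure P] {N : ℕ} {A : Ω → Matrix (Fin N) (Fin N) ℂ}, 1 ≤ N → IsGUE P A →
        P.real {ω | ε ≤ |largestEigenvalue (A ω) - 2|} ≤ b N := by
  -- Keeping `δ ≤ 1` makes the edge bound `2 + δ` give eigenvalues at least `-3`, as the
  -- deterministic lemma requires.
  set δ : ℝ := min ε 1 with hδ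
  have hδ0 : 0 < δ := by positivity
  have hδ1 : δ ≤ 1 := min_le_right _ _
  have hδε : δ ≤ ε := min_le_left _ _
  obtain ⟨b, hb, hbound⟩ := exists_summable_measureReal_eigenvalues hδ0
  obtain ⟨n, θ, hθ, hdet⟩ := exists_moment_bound_imp_lt_largestEigenvalue hδ0 hδ1
  choose C hC using exists_measureReal_le_abs_normTrace_sub_le
  refine ⟨fun N => b N + ∑ k ∈ Finset.range (n + 1), C k / θ ^ 2 * ((N : ℝ) ^ 2)⁻¹, ?_, ?_⟩
  · exact hb.add (summable_sum fun k _ =>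
      (Real.summable_nat_pow_inv.2 (by norm_num)).mul_left (C k / θ ^ 2))
  · intro Ω _ P _ N A hN hA
    have hsub : {ω | ε ≤ |largestEigenvalue (A ω) - 2|} ⊆
        {ω | ∃ i, 2 + δ ≤ |(hA.isHermitian ω).eigenvalues i|} ∪
          ⋃ k ∈ Finset.range (n + 1), {ω | θ ≤ |normTrace (A ω) k - semicircleMoment k|} := by
      intro ω hω
      by_contra hcon
      simp only [Set.mem_union, Set.mem_ofPred_eq, Set.mem_iUnion, not_or, not_exists, not_le,
        Finset.mem_range] at hcon hω
      obtain ⟨h1, h2⟩ := hcon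
      have hlow := hdet N (A ω) (hA.isHermitian ω) hN
        (fun i => by linarith [neg_abs_le ((hA.isHermitian ω).eigenvalues i), h1 i])
        (fun k hk => by linarith [(abs_lt.1 (h2 k (Nat.lt_succ_of_le hk))).1])
      obtain ⟨i, hi⟩ := (isGreatest_largestEigenvalue hN (hA.isHermitian ω)).1
      have hup := h1 i
      rw [hi] at hup
      have := le_abs_self (largestEigenvalue (A ω))
      rcases le_abs.1 hω with h | h <;> linarith
    refine (measureReal_mono hsub).trans ((measureReal_union_le _ _).trans
      (add_le_add (hbound hN hA) ((measureReal_biUnion_finset_le _ _).trans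
        (Finset.sum_le_sum fun k _ => hC k hN hA θ hθ))))

/-! ### Conclusion by Borel–Cantelli. -/

theorem corollary9p6 :
    (∀ (Ω : ℕ → Type*) [∀ N, MeasurableSpace (Ω N)] (P : ∀ N, Measure (Ω N))
        [∀ N, IsProbabilityMeasure (P N)]
        (A : ∀ N : ℕ, Ω N → Matrix (Fin N) (Fin N) ℂ),
        (∀ N, 1 ≤ N → IsGUE (P N) (A N)) →
        ∀ ε : ℝ, 0 < ε →
          Tendsto (fun N => P N {ω | ε ≤ |largestEigenvalue (A N ω) - 2|}) atTop (𝓝 0)) ∧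
    (∀ (Ω : Type*) [MeasurableSpace Ω] (P : Measure Ω) [IsProbabilityMeasure P]
        (A : ∀ N : ℕ, Ω → Matrix (Fin N) (Fin N) ℂ),
        (∀ N, 1 ≤ N → IsGUE P (A N)) →
        ∀ᵐ ω ∂P, Tendsto (fun N => largestEigenvalue (A N ω)) atTop (𝓝 2)) := by
  constructor
  · intro Ω _ P _ A hA ε hε
    obtain ⟨b, hb, hbound⟩ := exists_summable_measureReal_largestEigenvalue hε
    have hlim : Tendsto (fun N => ENNReal.ofReal (b N)) atTop (𝓝 0) := by
      simpa using ENNReal.tendsto_ofReal hb.tendsto_atTop_zero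
    refine tendsto_of_tendsto_of_tendsto_of_le_of_le' tendsto_const_nhds hlim
      (Eventually.of_forall fun _ => zero_le) ?_
    filter_upwards [eventually_ge_atTop 1] with N hN
    rw [← ofReal_measureReal]
    exact ENNReal.ofReal_le_ofReal (hbound hN (hA N hN))
  · intro Ω _ P _ A hA
    have key : ∀ m : ℕ, ∀ᵐ ω ∂P, ∀ᶠ N in atTop,
        |largestEigenvalue (A N ω) - 2| < 1 / ((m : ℝ) + 1) := by
      intro m
      obtain ⟨b, hb, hbound⟩ :=
        exists_summable_measureReal_largestEigenvalue (Nat.one_div_pos_of_nat (α := ℝ) (n := m))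
      -- The shift by one skips `N = 0`, where no GUE hypothesis is available.
      have hsum : ∑' N, P {ω | 1 / ((m : ℝ) + 1) ≤
          |largestEigenvalue (A (N + 1) ω) - 2|} ≠ ∞ := by
        refine ne_top_of_le_ne_top ((summable_nat_add_iff 1).2 hb).tsum_ofReal_ne_top
          (ENNReal.tsum_le_tsum fun N => ?_)
        rw [← ofReal_measureReal]
        exact ENNReal.ofReal_le_ofReal (hbound (by omega) (hA (N + 1) (by omega)))
      filter_upwards [ae_eventually_notMem hsum] with ω hω
      obtain ⟨N₀, hN₀⟩ := eventually_atTop.1 hω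
      refine eventually_atTop.2 ⟨N₀ + 1, fun N hN => ?_⟩
      obtain ⟨N, rfl⟩ : ∃ N', N = N' + 1 := ⟨N - 1, by omega⟩
      simpa using hN₀ N (by omega)
    filter_upwards [ae_all_iff.2 key] with ω hω
    rw [Metric.tendsto_nhds]
    intro ε hε
    obtain ⟨m, hm⟩ := exists_nat_one_div_lt hε
    filter_upwards [hω m] with N hN
    rw [Real.dist_eq]
    exact hN.trans hm
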